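/- Let $\mathbb{K}$ be an infinite field. A non-associative algebra over $\mathbb{K}$ is a $\mathbb{K}$-vector space with a bilinear multiplication; a variety $\mathcal{V}$ of non-associative algebras over $\mathbb{K}$ is the class of all such algebras that satisfy a given set of identities, with the linear multiplicative maps as morphisms. For an object $B$ of $\mathcal{V}$, a split extension over $B$ is a diagram $S=(0\to A\xrightarrow{k} G \rightleftarrows B\to 0)$ in $\mathcal{V}$, with $f\colon G\to B$, $s\colon B\to G$, $f\circ s=1_B$ and $k$ a kernel of $f$; we write $K(S)=A$. A morphism of split extensions over $B$ is a pair of morphisms between the kernel objects and between the middle objects which is compatible with $k$, $f$ and $s$ (and is the identity on $B$). We say that $\mathcal{V}$ admits a universal Kaluzhnin–Krasner embedding theorem for split extensions if for every object $B$ of $\mathcal{V}$ there are a functor $R$ from $\mathcal{V}$ to the category of split extensions over $B$ and morphisms $\eta_S\colon S\to R(K(S))$, natural in the split extension $S$ over $B$, such that every $\eta_S$ is an embedding (injective on middle objects) and, for every $S$, every object $C$ of $\mathcal{V}$ and every morphism $\alpha\colon S\to R(C)$, there is a unique morphism $\overline{\alpha}\colon K(S)\to C$ with $R(\overline{\alpha})\circ\eta_S=\alpha$.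 Theorem. Let $\mathcal{V}$ be a variety of non-associative algebras over an infinite field $\mathbb{K}$ which is non-abelian (that is, $xy=0$ is not an identity of $\mathcal{V}$) and, in case $\mathbb{K}$ has characteristic $2$, suppose that if $xy=-yx$ is an identity of $\mathcal{V}$ then so is $xx=0$ (this is automatic in any other characteristic). Then $\mathcal{V}$ admits a universal Kaluzhnin–Krasner embedding theorem for split extensions if and only if $\mathcal{V}$ is the variety of Lie algebras over $\mathbb{K}$ (defined by $xx=0$ and the Jacobi identity). In particular, over an infinite field $\mathbb{K}$, the varieties of associative algebras, of Jordan algebras (defined by $xy=yx$ and $(xy)(xx)=x(y(xx))$), of left Leibniz algebras and of right Leibniz algebras admit no such theorem. -/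

import Mathlib

open CategoryTheory

universe u

/-- A non-associative algebra over `K`: a `K`-vector space with a bilinear multiplication
(no associativity, commutativity or unit is required). -/
structure NAAlg (K : Type u) [Field K] where
  carrier : Type u
  [ring : NonUnitalNonAssocRing carrier]
  [module : Module K carrier]
  [scalarTower : IsScalarTower K carrier carrier]
  [smulComm : SMulCommClass K carrier carrier]

namespace NAAlg

variable {K : Type u} [Field K]

instance : CoeSort (NAAlg K) (Type u) := ⟨NAAlg.carrier⟩

attribute [instance] NAAlg.ring NAAlg.module NAAlg.scalarTower NAAlg.smulComm

/-- The non-associative polynomial `p` (in the variables `x₀, x₁, …`) is an identity of `A`: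
it vanishes under every substitution of elements of `A` for the variables. -/
def Satisfies (A : NAAlg K) (p : FreeNonUnitalNonAssocAlgebra K ℕ) : Prop :=
  ∀ v : ℕ → A, FreeNonUnitalNonAssocAlgebra.lift K v p = 0

end NAAlg

/-- A variety of non-associative algebras over `K`: a class of algebras that consists of all
algebras satisfying some set of identities. -/
@[ext]
structure NAVariety (K : Type u) [Field K] where
  mem : NAAlg K → Prop
  exists_identities : ∃ I : Set (FreeNonUnitalNonAssocAlgebra K ℕ),
    ∀ A : NAAlg K, mem A ↔ ∀ p ∈ I, A.Satisfies p

namespace NAVariety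

section Examples

variable (K : Type u) [Field K]

/-- The variety of all algebras that satisfy the identities in `I`. -/
def ofIdentities (I : Set (FreeNonUnitalNonAssocAlgebra K ℕ)) : NAVariety K where
  mem A := ∀ p ∈ I, A.Satisfies p
  exists_identities := ⟨I, fun _ => Iff.rfl⟩

/-- The `i`-th variable. -/
noncomputable def X (i : ℕ) : FreeNonUnitalNonAssocAlgebra K ℕ :=
  FreeNonUnitalNonAssocAlgebra.of K i

/-- Lie algebras: `xx = 0` and the Jacobi identity `x(yz) + y(zx) + z(xy) = 0`. -/
noncomputable def lie : NAVariety K :=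
  ofIdentities K {X K 0 * X K 0,
    X K 0 * (X K 1 * X K 2) + X K 1 * (X K 2 * X K 0) + X K 2 * (X K 0 * X K 1)}

/-- Associative algebras: `(xy)z = x(yz)`. -/
noncomputable def associative : NAVariety K :=
  ofIdentities K {X K 0 * X K 1 * X K 2 - X K 0 * (X K 1 * X K 2)}

/-- Jordan algebras: `xy = yx` and `(xy)(xx) = x(y(xx))`. -/
noncomputable def jordan : NAVariety K :=
  ofIdentities K {X K 0 * X K 1 - X K 1 * X K 0,
    X K 0 * X K 1 * (X K 0 * X K 0) - X K 0 * (X K 1 * (X K 0 * X K 0))}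

/-- Left Leibniz algebras: `x(yz) = (xy)z + y(xz)`. -/
noncomputable def leftLeibniz : NAVariety K :=
  ofIdentities K {X K 0 * (X K 1 * X K 2) - (X K 0 * X K 1 * X K 2 + X K 1 * (X K 0 * X K 2))}

/-- Right Leibniz algebras: `(xy)z = (xz)y + x(yz)`. -/
noncomputable def rightLeibniz : NAVariety K :=
  ofIdentities K {X K 0 * X K 1 * X K 2 - (X K 0 * X K 2 * X K 1 + X K 0 * (X K 1 * X K 2))}

end Examples

variable {K : Type u} [Field K]

/-- The objects of the category of algebras in the variety `V`. -/
structure Obj (V : NAVariety K) where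
  alg : NAAlg K
  mem : V.mem alg

instance (V : NAVariety K) : CoeSort V.Obj (Type u) := ⟨fun A => A.alg.carrier⟩

/-- A variety as a category: morphisms are all `K`-linear multiplicative maps. -/
instance (V : NAVariety K) : Category.{u} V.Obj where
  Hom A B := A →ₙₐ[K] B
  id A := NonUnitalAlgHom.id K A
  comp f g := NonUnitalAlgHom.comp g f

/-- A split extension `0 → A → G ⇄ B → 0` over `B` in the variety `V`. -/
structure SplitExt (V : NAVariety K) (B : V.Obj) where
  /-- the kernel object -/
  A : V.Obj
  /-- the middle object -/
  G : V.Obj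
  k : A →ₙₐ[K] G
  f : G →ₙₐ[K] B
  s : B →ₙₐ[K] G
  f_s : ∀ b, f (s b) = b
  k_injective : Function.Injective k
  exact : ∀ g, f g = 0 ↔ ∃ a, k a = g

namespace SplitExt

variable {V : NAVariety K} {B : V.Obj}

/-- A morphism of split extensions over `B` (the identity on `B`). -/
@[ext]
structure Hom (S T : V.SplitExt B) where
  onKernel : S.A →ₙₐ[K] T.A
  onMiddle : S.G →ₙₐ[K] T.G
  comm_k : ∀ a, onMiddle (S.k a) = T.k (onKernel a)
  comm_f : ∀ g, T.f (onMiddle g) = S.f g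
  comm_s : ∀ b, onMiddle (S.s b) = T.s b

instance : Category.{u} (V.SplitExt B) where
  Hom := Hom
  id S :=
    { onKernel := NonUnitalAlgHom.id K S.A
      onMiddle := NonUnitalAlgHom.id K S.G
      comm_k := fun _ => rfl
      comm_f := fun _ => rfl
      comm_s := fun _ => rfl }
  comp φ ψ :=
    { onKernel := ψ.onKernel.comp φ.onKernel
      onMiddle := ψ.onMiddle.comp φ.onMiddle
      comm_k := fun a => by simp [φ.comm_k, ψ.comm_k]
      comm_f := fun g => by simp [φ.comm_f, ψ.comm_f]
      comm_s := fun b => by simp [φ.comm_s, ψ.comm_s] }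

end SplitExt

/-- The forgetful functor that sends a split extension over `B` to its kernel object. -/
def kernelFunctor (V : NAVariety K) (B : V.Obj) : V.SplitExt B ⥤ V.Obj where
  obj S := S.A
  map φ := φ.onKernel

/-- `V` admits a universal Kaluzhnin–Krasner embedding theorem for split extensions: for each `B`
there is a functor `R` from `V` to split extensions over `B` and, naturally in the split extension
`S = (0 → A → G ⇄ B → 0)`, an embedding `η_S : S ⟶ R(A)` which is universal, i.e. every morphism
`α : S ⟶ R(C)` is `R(ᾱ) ∘ η_S` for a unique morphism `ᾱ : A ⟶ C`. -/
def AdmitsUniversalEmbedding (V : NAVariety K) : Prop :=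
  ∀ B : V.Obj, ∃ (R : V.Obj ⥤ V.SplitExt B) (η : 𝟭 (V.SplitExt B) ⟶ V.kernelFunctor B ⋙ R),
    (∀ S : V.SplitExt B, Function.Injective (SplitExt.Hom.onMiddle (η.app S))) ∧
    ∀ (S : V.SplitExt B) (C : V.Obj) (α : S ⟶ R.obj C),
      ∃! α' : (V.kernelFunctor B).obj S ⟶ C, η.app S ≫ R.map α' = α

/-- Not all products vanish in `V`, i.e. `xy = 0` is not an identity of `V`. -/
def IsNonabelian (V : NAVariety K) : Prop :=
  ∃ A : V.Obj, ∃ x y : A, x * y ≠ 0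

/-- `xy = -yx` is an identity of `V`. -/
def IsAnticommutative (V : NAVariety K) : Prop :=
  ∀ (A : V.Obj) (x y : A), x * y = -(y * x)

/-- `xx = 0` is an identity of `V`. -/
def IsAlternating (V : NAVariety K) : Prop :=
  ∀ (A : V.Obj) (x : A), x * x = 0

end NAVariety

/-! The universal property says that `R` is right adjoint to the functor sending a split extension
to its kernel. Conversely the unit of such an adjunction is an embedding, since on kernels it is
split by the counit. So the question is which varieties have cofree split extensions (`HasCofree`).

Over an infinite field a variety is closed under dual numbers, so identities can be studied through
multilinear parts. Cofreeness has two consequences. First, if `x` and `y` lie in `B`-stable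
subalgebras of a subalgebra `C`, then `b(xy)` lies in `C` even when `C` is not stable
(`HasCofree.mul_mem`). Applied to generic elements with infinitesimal coefficients, this makes
`b(xy)` a fixed linear combination of the products of `bx` with `y` and of `by` with `x`
(`HasCofree.exists_rewrite`). Secondly, one cofree object contains many copies of the adjoint module
of `B` whose mutual products can be prescribed through the counit (`HasCofree.exists_pairing`).
These test modules turn identities into equations between scalars.

If `V` is neither commutative nor anticommutative, some `aa'` and `a'a` are linearly independent.
The rewriting rule then gives a 4 by 4 matrix `R` with `R³ = 1` and `TRT = R²`, where `T` swaps the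
inner variables, and a quadratic relation that makes four 2 by 2 matrices span a multiplicatively
closed space. Burnside's theorem shows that this is impossible (`rotation_contradiction`). Otherwise
`xy = ηyx` for a scalar `η`, and comparing coefficients gives `b(xy) = -η((bx)y + x(by))`. For `η =
1` this forces characteristic two, so in all cases `V` is anticommutative and left multiplications
are derivations (`HasCofree.leibniz`). With `xx = 0`, every algebra in `V` is a Lie algebra.

`V` is no smaller: an associative polynomial in left multiplications that vanishes on all of `V` is
zero (`HasCofree.coeff_eq_zero`), so an identity of `V` becomes zero when products are read as
commutators. It then holds in every Lie algebra, because each has a faithful representation by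
Poincaré–Birkhoff–Witt.

For Lie algebras the cofree extension is the semidirect product of `B` with `Hom(U(B), C)`, whose
bracket is convolution (`hasCofree_lie`). The other four varieties each contain an algebra that
violates anticommutativity or the Leibniz rule. -/

namespace NAVariety

open FreeNonUnitalNonAssocAlgebra TensorProduct Polynomial

variable {K : Type u} [Field K]

/-! ### Closure properties of varieties -/

section Closure

theorem lift_map {A B : NAAlg K} (f : A →ₙₐ[K] B) (v : ℕ → A)
    (p : FreeNonUnitalNonAssocAlgebra K ℕ) :
    f (FreeNonUnitalNonAssocAlgebra.lift K v p) =
      FreeNonUnitalNonAssocAlgebra.lift K (fun i => f (v i)) p := by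
  have h : f.comp (FreeNonUnitalNonAssocAlgebra.lift K v) =
      FreeNonUnitalNonAssocAlgebra.lift K (fun i => f (v i)) :=
    FreeNonUnitalNonAssocAlgebra.hom_ext K fun i => by simp
  exact DFunLike.congr_fun h p

/-- A value of an identity dies under every map to a member, hence is zero if the maps are jointly
injective. This covers subalgebras and products at once. -/
theorem mem_of_separating (V : NAVariety K) {ι : Type*} {A : NAAlg K} (B : ι → NAAlg K)
    (hB : ∀ i, V.mem (B i)) (f : ∀ i, A →ₙₐ[K] B i)
    (hf : ∀ a : A, (∀ i, f i a = 0) → a = 0) : V.mem A := by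
  obtain ⟨I, hI⟩ := V.exists_identities
  rw [hI]
  intro p hp v
  refine hf _ fun i => ?_
  rw [lift_map]
  exact (hI _).1 (hB i) p hp _

theorem mem_of_injective (V : NAVariety K) {A B : NAAlg K} (hB : V.mem B) (f : A →ₙₐ[K] B)
    (hf : Function.Injective f) : V.mem A :=
  V.mem_of_separating (ι := Unit) (fun _ => B) (fun _ => hB) (fun _ => f) fun a ha =>
    hf (by rw [ha (), map_zero])

theorem mem_of_surjective (V : NAVariety K) {A B : NAAlg K} (hA : V.mem A) (f : A →ₙₐ[K] B)
    (hf : Function.Surjective f) : V.mem B := by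
  obtain ⟨I, hI⟩ := V.exists_identities
  rw [hI]
  intro p hp v
  choose w hw using fun i => hf (v i)
  have h : v = fun i => f (w i) := funext fun i => (hw i).symm
  rw [h, ← lift_map, (hI _).1 hA p hp, map_zero]

/-- A subalgebra of an object, as an object. -/
abbrev Obj.sub {V : NAVariety K} (A : V.Obj) (S : NonUnitalSubalgebra K A) : V.Obj where
  alg := { carrier := S }
  mem := V.mem_of_injective (A := { carrier := S }) A.mem (NonUnitalSubalgebraClass.subtype S)
    Subtype.val_injective

/-- The product of two objects. -/
abbrev Obj.prod {V : NAVariety K} (A B : V.Obj) : V.Obj where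
  alg := { carrier := A × B }
  mem := by
    refine V.mem_of_separating (A := { carrier := A × B }) (ι := Bool)
      (fun b => cond b A.alg B.alg) (fun b => by cases b; exacts [B.mem, A.mem])
      (fun b => match b with
        | true => NonUnitalAlgHom.fst K A B
        | false => NonUnitalAlgHom.snd K A B) fun a ha => ?_
    exact Prod.ext (ha true) (ha false)

/-- The product of a family of objects. -/
abbrev Obj.pi {V : NAVariety K} {ι : Type u} (A : ι → V.Obj) : V.Obj where
  alg := { carrier := ∀ i, A i }
  mem := V.mem_of_separating (A := { carrier := ∀ i, A i }) (fun i => (A i).alg)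
    (fun i => (A i).mem)
    (fun i => { toFun := fun a => a i
                map_smul' := fun _ _ => rfl
                map_zero' := rfl
                map_add' := fun _ _ => rfl
                map_mul' := fun _ _ => rfl })
    fun _ ha => funext ha

/-- Evaluation of polynomials with coefficients in an algebra. -/
noncomputable def evalCoeff (A : NAAlg K) (t : K) : K[X] ⊗[K] A →ₙₐ[K] A where
  toFun := TensorProduct.lift ((LinearMap.lsmul K A).comp (Polynomial.aeval t).toLinearMap)
  map_smul' := fun c x => by simp
  map_zero' := map_zero _
  map_add' := fun x y => map_add _ x y
  map_mul' := fun x y => by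
    induction x with
    | zero => simp
    | add x₁ x₂ h₁ h₂ => rw [add_mul, map_add, h₁, h₂, map_add, add_mul]
    | tmul p a =>
      induction y with
      | zero => simp
      | add x₁ x₂ h₁ h₂ => rw [mul_add, map_add, h₁, h₂, map_add, mul_add]
      | tmul q b => simp [smul_mul_assoc, mul_smul_comm, smul_smul, mul_comm]

@[simp] theorem evalCoeff_tmul (A : NAAlg K) (t : K) (p : K[X]) (a : A) :
    evalCoeff A t (p ⊗ₜ a) = p.eval t • a := by
  simp [evalCoeff]

/-- In a basis of `A` the coordinates are polynomials in one variable vanishing at every scalar.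
This is where infinitude of the field enters. -/
theorem eq_zero_of_evalCoeff [Infinite K] (A : NAAlg K) (x : K[X] ⊗[K] A)
    (hx : ∀ t, evalCoeff A t x = 0) : x = 0 := by
  classical
  let b := Module.Basis.ofVectorSpace K A
  let e := TensorProduct.equivFinsuppOfBasisRight (M := K[X]) b
  have key : ∀ (t : K) (y : K[X] ⊗[K] A) i, b.repr (evalCoeff A t y) i = (e y i).eval t := by
    intro t y i
    induction y with
    | zero => simp
    | add x₁ x₂ h₁ h₂ => simp [h₁, h₂]
    | tmul p a =>
      simp [e, mul_comm]
  apply e.injective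
  rw [map_zero]
  ext1 i
  refine Polynomial.funext fun t => ?_
  rw [← key, hx]
  simp

end Closure

/-! ### Dual numbers and generic elements -/

/-- The algebra of dual numbers over `A`. -/
@[ext] structure Dual (A : Type u) where
  re : A
  im : A

namespace Dual

variable (A : Type u)

/-- Dual numbers as pairs. -/
def equivProd : Dual A ≃ A × A where
  toFun x := (x.re, x.im)
  invFun x := ⟨x.1, x.2⟩
  left_inv _ := rfl
  right_inv _ := rfl

variable [NonUnitalNonAssocRing A] [Module K A]

instance : AddCommGroup (Dual A) := (equivProd A).addCommGroup
instance : Module K (Dual A) := (equivProd A).module K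

variable {A}

@[simp] theorem re_zero : (0 : Dual A).re = 0 := rfl
@[simp] theorem im_zero : (0 : Dual A).im = 0 := rfl
@[simp] theorem re_add (x y : Dual A) : (x + y).re = x.re + y.re := rfl
@[simp] theorem im_add (x y : Dual A) : (x + y).im = x.im + y.im := rfl
@[simp] theorem re_smul (c : K) (x : Dual A) : (c • x).re = c • x.re := rfl
@[simp] theorem im_smul (c : K) (x : Dual A) : (c • x).im = c • x.im := rfl

instance : Mul (Dual A) := ⟨fun x y => ⟨x.re * y.re, x.re * y.im + x.im * y.re⟩⟩

@[simp] theorem re_mul (x y : Dual A) : (x * y).re = x.re * y.re := rfl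
@[simp] theorem im_mul (x y : Dual A) : (x * y).im = x.re * y.im + x.im * y.re := rfl

instance : NonUnitalNonAssocRing (Dual A) where
  left_distrib x y z := by ext <;> simp [mul_add]; abel
  right_distrib x y z := by ext <;> simp [add_mul]; abel
  zero_mul x := by ext <;> simp
  mul_zero x := by ext <;> simp

variable [IsScalarTower K A A] [SMulCommClass K A A]

instance : IsScalarTower K (Dual A) (Dual A) where
  smul_assoc c x y := by ext <;> simp [smul_mul_assoc]

instance : SMulCommClass K (Dual A) (Dual A) where
  smul_comm c x y := by ext <;> simp [mul_smul_comm]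

/-- The real part, as a linear map. -/
@[simps] def reₗ : Dual A →ₗ[K] A where
  toFun := re
  map_add' _ _ := rfl
  map_smul' _ _ := rfl

/-- The infinitesimal part, as a linear map. -/
@[simps] def imₗ : Dual A →ₗ[K] A where
  toFun := im
  map_add' _ _ := rfl
  map_smul' _ _ := rfl

/-- The inclusion of an algebra into its dual numbers. -/
@[simps] def inl : A →ₙₐ[K] Dual A where
  toFun a := ⟨a, 0⟩
  map_smul' _ _ := by ext <;> simp
  map_zero' := rfl
  map_add' _ _ := by ext <;> simp
  map_mul' _ _ := by ext <;> simp

end Dual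

/-- The map from polynomials with coefficients in `A` to dual numbers. -/
noncomputable def toDual (A : NAAlg K) : K[X] ⊗[K] A →ₙₐ[K] Dual A where
  toFun x := ⟨evalCoeff A 0 x, TensorProduct.lift ((LinearMap.lsmul K A).comp
    ((Polynomial.leval (0 : K)).comp Polynomial.derivative)) x⟩
  map_smul' := fun c x => by ext <;> simp
  map_zero' := by ext <;> simp
  map_add' := fun x y => by ext <;> simp
  map_mul' := fun x y => by
    induction x with
    | zero => ext <;> simp
    | add x₁ x₂ h₁ h₂ =>
      simp only [Dual.ext_iff, Dual.re_mul, Dual.im_mul] at h₁ h₂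
      ext
      · simp [add_mul]
      · simp only [add_mul, map_add, h₁, h₂, Dual.im_mul]
        abel
    | tmul p a =>
      induction y with
      | zero => ext <;> simp
      | add x₁ x₂ h₁ h₂ =>
        simp only [Dual.ext_iff, Dual.re_mul, Dual.im_mul] at h₁ h₂
        ext
        · simp [mul_add]
        · simp only [mul_add, map_add, h₁, h₂, Dual.im_mul]
          abel
      | tmul q b =>
        ext
        · simp [smul_mul_assoc, mul_smul_comm, smul_smul, mul_comm]
        · simp [smul_mul_assoc, mul_smul_comm, smul_smul, mul_comm, add_comm]

/-- The dual numbers over an object. -/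
abbrev Obj.dual [Infinite K] {V : NAVariety K} (A : V.Obj) : V.Obj where
  alg := { carrier := Dual A }
  mem := by
    -- Polynomials over `A` embed into a power of `A` by evaluation, and `f ↦ f(0) + f'(0)ε` maps
    -- them onto the dual numbers.
    have hP : V.mem { carrier := K[X] ⊗[K] A } :=
      V.mem_of_separating (A := { carrier := K[X] ⊗[K] A }) (fun _ : K => A.alg)
        (fun _ => A.mem) (evalCoeff A.alg) (eq_zero_of_evalCoeff A.alg)
    refine V.mem_of_surjective (B := { carrier := Dual A }) hP (toDual A.alg) fun x => ?_
    refine ⟨(1 : K[X]) ⊗ₜ x.re + (Polynomial.X : K[X]) ⊗ₜ x.im, ?_⟩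
    ext <;> simp [toDual]

/-- An object with a sequence of elements that satisfies only the identities of the variety. -/
theorem exists_generic (V : NAVariety K) : ∃ (Ω : V.Obj) (ξ : ℕ → Ω),
    ∀ p, FreeNonUnitalNonAssocAlgebra.lift K ξ p = 0 →
      ∀ (A : V.Obj) (v : ℕ → A), FreeNonUnitalNonAssocAlgebra.lift K v p = 0 := by
  classical
  -- There is one factor for each polynomial that is not an identity, equipped with a substitution
  -- that witnesses this.
  let ι := {p : FreeNonUnitalNonAssocAlgebra K ℕ //
    ∃ (A : V.Obj) (v : ℕ → A), FreeNonUnitalNonAssocAlgebra.lift K v p ≠ 0}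
  choose A v hv using fun p : ι => p.2
  let A' : ULift.{u} ι → V.Obj := fun p => A p.down
  refine ⟨Obj.pi A', fun n p => v p.down n, fun p hp B w => ?_⟩
  by_contra hne
  let i : ULift.{u} ι := ⟨⟨p, B, w, hne⟩⟩
  let f : (Obj.pi A').alg →ₙₐ[K] (A' i).alg :=
    { toFun := fun a => a i
      map_smul' := fun _ _ => rfl
      map_zero' := rfl
      map_add' := fun _ _ => rfl
      map_mul' := fun _ _ => rfl }
  have h := lift_map f (fun n p => v p.down n) p
  rw [hp, map_zero] at h
  exact hv i.down h.symm

end NAVariety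

/-! ### Cofree split extensions and their first consequences -/

namespace NAVariety

variable {K : Type u} [Field K] {V : NAVariety K}

/-- Kernels of split extensions have cofree objects. -/
def HasCofree (V : NAVariety K) : Prop :=
  ∀ B C : V.Obj, ∃ (T : V.SplitExt B) (ε : T.A →ₙₐ[K] C), ∀ (S : V.SplitExt B) (φ : S.A →ₙₐ[K] C),
    ∃! α : SplitExt.Hom S T, ∀ a, ε (α.onKernel a) = φ a

/-- The counit `ε` is the morphism that corresponds to the identity of `R(C)`. Naturality of `η`
shows that any `α` into `R(C)` corresponds to `ε` after `α` on kernels. -/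
theorem AdmitsUniversalEmbedding.hasCofree (hV : V.AdmitsUniversalEmbedding) : V.HasCofree := by
  intro B C
  obtain ⟨R, η, -, h⟩ := hV B
  obtain ⟨ε, hε, -⟩ := h (R.obj C) C (𝟙 _)
  refine ⟨R.obj C, ε, fun S φ => ?_⟩
  have key : ∀ α : S ⟶ R.obj C, η.app S ≫ R.map ((V.kernelFunctor B).map α ≫ ε) = α := by
    intro α
    have hn := η.naturality α
    simp only [Functor.id_map, Functor.comp_map] at hn
    rw [R.map_comp, ← Category.assoc, ← hn, Category.assoc]
    refine Eq.trans (congrArg (fun f => α ≫ f) hε) (Category.comp_id α)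
  let φ' : (V.kernelFunctor B).obj S ⟶ C := φ
  refine ⟨η.app S ≫ R.map φ', ?_, ?_⟩
  · obtain ⟨β, -, hβ⟩ := h S C (η.app S ≫ R.map φ')
    have h₁ := hβ φ' rfl
    have h₂ := hβ _ (key (η.app S ≫ R.map φ'))
    intro a
    exact congrArg (fun f : S.A →ₙₐ[K] C => f a) (h₂.trans h₁.symm)
  · intro α hα
    have : (V.kernelFunctor B).map α ≫ ε = φ' := NonUnitalAlgHom.ext hα
    rw [← this]
    exact (key α).symm

/-- The split extension over `B` determined by a morphism `s₀ : B ⟶ H` and a subalgebra `A₁` of `H`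
that is stable under multiplication by the image of `s₀`. -/
def SplitExt.ofStable {B H : V.Obj} (s₀ : B →ₙₐ[K] H) (A₁ : NonUnitalSubalgebra K H)
    (hl : ∀ b, ∀ a ∈ A₁, s₀ b * a ∈ A₁) (hr : ∀ b, ∀ a ∈ A₁, a * s₀ b ∈ A₁) : V.SplitExt B where
  A := H.sub A₁
  -- Working inside `B × H` keeps the base as a separate coordinate, so `s₀` need not be injective
  -- and its image may meet `A₁`.
  G := (B.prod H).sub
    { carrier := {x | x.2 - s₀ x.1 ∈ A₁}
      zero_mem' := by
        show (0 : H) - s₀ 0 ∈ A₁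
        simp
      add_mem' := fun {x y} hx hy => by
        have hx' : x.2 - s₀ x.1 ∈ A₁ := hx
        have hy' : y.2 - s₀ y.1 ∈ A₁ := hy
        show x.2 + y.2 - s₀ (x.1 + y.1) ∈ A₁
        convert add_mem hx' hy' using 1
        rw [map_add]
        abel
      smul_mem' := fun c x hx => by
        have hx' : x.2 - s₀ x.1 ∈ A₁ := hx
        show c • x.2 - s₀ (c • x.1) ∈ A₁
        rw [map_smul, ← smul_sub]
        exact SMulMemClass.smul_mem c hx'
      mul_mem' := fun {x y} hx hy => by
        have hx' : x.2 - s₀ x.1 ∈ A₁ := hx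
        have hy' : y.2 - s₀ y.1 ∈ A₁ := hy
        show x.2 * y.2 - s₀ (x.1 * y.1) ∈ A₁
        convert add_mem (add_mem (mul_mem hx' hy') (hl x.1 _ hy')) (hr y.1 _ hx') using 1
        rw [map_mul]
        simp only [mul_sub, sub_mul]
        abel }
  k :=
    { toFun := fun a => ⟨(0, a.1), by
        show a.1 - s₀ 0 ∈ A₁
        simp⟩
      map_smul' := fun c a => Subtype.ext (Prod.ext (by simp) rfl)
      map_zero' := rfl
      map_add' := fun a b => Subtype.ext (Prod.ext (by simp) rfl)
      map_mul' := fun a b => Subtype.ext (Prod.ext (by simp) rfl) }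
  f := (NonUnitalAlgHom.fst K B H).comp (NonUnitalSubalgebraClass.subtype _)
  s :=
    { toFun := fun b => ⟨(b, s₀ b), by
        show s₀ b - s₀ b ∈ A₁
        simp⟩
      map_smul' := fun c a => Subtype.ext (Prod.ext rfl (by simp))
      map_zero' := Subtype.ext (Prod.ext rfl (by simp))
      map_add' := fun a b => Subtype.ext (Prod.ext rfl (by simp))
      map_mul' := fun a b => Subtype.ext (Prod.ext rfl (by simp)) }
  f_s _ := rfl
  k_injective a b h := Subtype.ext (congrArg (fun x => x.1.2) h)
  exact g := by
    constructor
    · intro h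
      have h' : g.1.1 = 0 := h
      have hg : g.1.2 - s₀ g.1.1 ∈ A₁ := g.2
      simp only [h', map_zero, sub_zero] at hg
      exact ⟨⟨g.1.2, hg⟩, Subtype.ext (Prod.ext h'.symm rfl)⟩
    · rintro ⟨a, rfl⟩
      rfl

/-- The inclusion of split extensions induced by an inclusion of stable subalgebras. -/
def SplitExt.ofStableLE {B H : V.Obj} (s₀ : B →ₙₐ[K] H) {A₁ A₂ : NonUnitalSubalgebra K H}
    (hl : ∀ b, ∀ a ∈ A₁, s₀ b * a ∈ A₁) (hr : ∀ b, ∀ a ∈ A₁, a * s₀ b ∈ A₁)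
    (hl' : ∀ b, ∀ a ∈ A₂, s₀ b * a ∈ A₂) (hr' : ∀ b, ∀ a ∈ A₂, a * s₀ b ∈ A₂) (h : A₁ ≤ A₂) :
    SplitExt.Hom (SplitExt.ofStable s₀ A₁ hl hr) (SplitExt.ofStable s₀ A₂ hl' hr') where
  onKernel := NonUnitalSubalgebra.inclusion h
  onMiddle :=
    { toFun := fun x => ⟨x.1, h x.2⟩
      map_smul' := fun _ _ => rfl
      map_zero' := rfl
      map_add' := fun _ _ => rfl
      map_mul' := fun _ _ => rfl }
  comm_k _ := rfl
  comm_f _ := rfl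
  comm_s _ := rfl

/-- The action of the base on the kernel of a split extension. -/
theorem SplitExt.exists_k_eq {B : V.Obj} (T : V.SplitExt B) (b : B) (a : T.A) :
    (∃ a', T.k a' = T.s b * T.k a) ∧ ∃ a', T.k a' = T.k a * T.s b := by
  have h : T.f (T.k a) = 0 := (T.exact _).2 ⟨a, rfl⟩
  constructor <;> refine (T.exact _).1 ?_ <;> simp [h]

/-- Both `A₁` and `A₂` map to the cofree extension over `C`. In the cofree extension over `H` these
maps agree with the one from all of `H`, by uniqueness. Hence the image of `xy` comes from the
cofree extension over `C`, where `b` acts, so the counit sends `b(xy)` into `C`. -/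
theorem HasCofree.mul_mem (hV : V.HasCofree) {B H : V.Obj} (s₀ : B →ₙₐ[K] H)
    {A₁ A₂ C : NonUnitalSubalgebra K H}
    (hl₁ : ∀ b, ∀ a ∈ A₁, s₀ b * a ∈ A₁) (hr₁ : ∀ b, ∀ a ∈ A₁, a * s₀ b ∈ A₁)
    (hl₂ : ∀ b, ∀ a ∈ A₂, s₀ b * a ∈ A₂) (hr₂ : ∀ b, ∀ a ∈ A₂, a * s₀ b ∈ A₂)
    (h₁ : A₁ ≤ C) (h₂ : A₂ ≤ C) (b : B) {x y : H} (hx : x ∈ A₁) (hy : y ∈ A₂) :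
    s₀ b * (x * y) ∈ C ∧ x * y * s₀ b ∈ C := by
  let S := SplitExt.ofStable s₀ ⊤ (fun _ _ _ => trivial) (fun _ _ _ => trivial)
  let S₁ := SplitExt.ofStable s₀ A₁ hl₁ hr₁
  let S₂ := SplitExt.ofStable s₀ A₂ hl₂ hr₂
  let i₁ : SplitExt.Hom S₁ S := SplitExt.ofStableLE s₀ hl₁ hr₁ _ _ le_top
  let i₂ : SplitExt.Hom S₂ S := SplitExt.ofStableLE s₀ hl₂ hr₂ _ _ le_top
  obtain ⟨T₀, ε₀, h₀⟩ := hV B (H.sub C)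
  obtain ⟨T, ε, hT⟩ := hV B H
  let ι : (H.sub C) →ₙₐ[K] H := NonUnitalSubalgebraClass.subtype C
  obtain ⟨ρ, hρ, -⟩ := hT T₀ (ι.comp ε₀)
  obtain ⟨η, hη, -⟩ := hT S (NonUnitalSubalgebraClass.subtype _)
  obtain ⟨α₁, hα₁, -⟩ := h₀ S₁ (NonUnitalSubalgebra.inclusion h₁)
  obtain ⟨α₂, hα₂, -⟩ := h₀ S₂ (NonUnitalSubalgebra.inclusion h₂)
  let comp {X Y Z : V.SplitExt B} (f : SplitExt.Hom X Y) (g : SplitExt.Hom Y Z) :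
      SplitExt.Hom X Z := CategoryStruct.comp (obj := V.SplitExt B) f g
  have e₁ : comp α₁ ρ = comp i₁ η := by
    refine (hT S₁ (NonUnitalSubalgebraClass.subtype _)).unique (fun a => ?_) (fun a => ?_)
    · exact (hρ _).trans (congrArg ι (hα₁ a))
    · exact hη _
  have e₂ : comp α₂ ρ = comp i₂ η := by
    refine (hT S₂ (NonUnitalSubalgebraClass.subtype _)).unique (fun a => ?_) (fun a => ?_)
    · exact (hρ _).trans (congrArg ι (hα₂ a))
    · exact hη _
  let x₁ : S₁.A := ⟨x, hx⟩
  let y₂ : S₂.A := ⟨y, hy⟩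
  have m₁ : η.onKernel (i₁.onKernel x₁) = ρ.onKernel (α₁.onKernel x₁) :=
    (DFunLike.congr_fun (congrArg SplitExt.Hom.onKernel e₁) x₁).symm
  have m₂ : η.onKernel (i₂.onKernel y₂) = ρ.onKernel (α₂.onKernel y₂) :=
    (DFunLike.congr_fun (congrArg SplitExt.Hom.onKernel e₂) y₂).symm
  have main : ∀ (w : T₀.A) (z : S.A), η.onKernel z = ρ.onKernel w → z.1 ∈ C := by
    intro w z h
    have := hη z
    rw [h, hρ] at this
    have h' : z.1 = ι (ε₀ w) := this.symm
    rw [h']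
    exact (ε₀ w).2
  obtain ⟨⟨w, hw⟩, w', hw'⟩ := T₀.exists_k_eq b (α₁.onKernel x₁ * α₂.onKernel y₂)
  constructor
  · let z : S.A := ⟨s₀ b * (x * y), NonUnitalAlgebra.mem_top⟩
    refine main w z (T.k_injective ((η.comm_k z).symm.trans ?_))
    rw [← ρ.comm_k, hw, map_mul, map_mul, map_mul, ρ.comm_s, ρ.comm_k,
      ρ.comm_k, ← m₁, ← m₂, ← η.comm_k, ← η.comm_k, ← η.comm_s, ← map_mul, ← map_mul]
    refine congrArg η.onMiddle (Subtype.ext (Prod.ext ?_ rfl))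
    show (0 : B) = b * (0 * 0)
    simp
  · let z : S.A := ⟨x * y * s₀ b, NonUnitalAlgebra.mem_top⟩
    refine main w' z (T.k_injective ((η.comm_k z).symm.trans ?_))
    rw [← ρ.comm_k, hw', map_mul, map_mul, map_mul, ρ.comm_s, ρ.comm_k,
      ρ.comm_k, ← m₁, ← m₂, ← η.comm_k, ← η.comm_k, ← η.comm_s, ← map_mul, ← map_mul]
    refine congrArg η.onMiddle (Subtype.ext (Prod.ext ?_ rfl))
    show (0 : B) = 0 * 0 * b
    simp

/-- An algebra with a subalgebra `B` and an ideal `A` over `C` that contains, for each functional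
`φ` on `B` and each element `c` of `C` of square zero, a copy of the adjoint module of `B` on which
the map to `C` is given by `φ` and `c`. -/
structure Wreath {V : NAVariety K} (B C : V.Obj) where
  G : V.Obj
  A : V.Obj
  s : B →ₙₐ[K] G
  k : A →ₙₐ[K] G
  k_injective : Function.Injective k
  ε : A →ₙₐ[K] C
  α : (B →ₗ[K] K) → C → B →ₗ[K] A
  s_mul : ∀ φ c, c * c = 0 → ∀ b z, s b * k (α φ c z) = k (α φ c (b * z))
  mul_s : ∀ φ c, c * c = 0 → ∀ b z, k (α φ c z) * s b = k (α φ c (z * b))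
  ε_α : ∀ φ c, c * c = 0 → ∀ z, ε (α φ c z) = φ z • c

/-- The infinitesimal ideal of the dual numbers over `B` is the adjoint module with zero product. So
`z ↦ φ(z)c` is multiplicative on it as soon as `c² = 0`, and lifts equivariantly to the cofree
extension over `C`. All the copies live in this one extension, so they can be multiplied with each
other. -/
theorem HasCofree.nonempty_wreath [Infinite K] (hV : V.HasCofree) (B C : V.Obj) :
    Nonempty (Wreath B C) := by
  classical
  obtain ⟨T, ε, hT⟩ := hV B C
  let A₁ : NonUnitalSubalgebra K B.dual :=
    { carrier := {x | x.re = 0}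
      zero_mem' := rfl
      add_mem' := fun {x y} hx hy => by
        simp only [Set.mem_ofPred_eq] at hx hy
        simp [hx, hy]
      smul_mem' := fun c x hx => by
        simp only [Set.mem_ofPred_eq] at hx
        simp [hx]
      mul_mem' := fun {x y} hx hy => by
        simp only [Set.mem_ofPred_eq] at hx hy
        simp [hx] }
  have hA₁ : ∀ x, x ∈ A₁ ↔ x.re = 0 := fun _ => Iff.rfl
  let S : V.SplitExt B := SplitExt.ofStable (H := B.dual) Dual.inl A₁
    (fun b a ha => by rw [hA₁] at ha ⊢; simp [ha]) (fun b a ha => by rw [hA₁] at ha ⊢; simp [ha])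
  let Φ : (B →ₗ[K] K) → (c : C) → c * c = 0 → S.A →ₙₐ[K] C := fun φ c hc =>
    { toFun := fun x => φ x.1.im • c
      map_smul' := fun t x => by
        show φ (t • x.1).im • c = t • φ x.1.im • c
        simp [mul_smul]
      map_zero' := by
        show φ (0 : Dual B).im • c = 0
        simp
      map_add' := fun x y => by
        show φ (x.1 + y.1).im • c = φ x.1.im • c + φ y.1.im • c
        simp [add_smul]
      map_mul' := fun x y => by
        have hx : x.1.re = 0 := x.2
        have hy : y.1.re = 0 := y.2
        show φ (x.1 * y.1).im • c = φ x.1.im • c * φ y.1.im • c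
        simp [hx, hy, smul_mul_assoc, mul_smul_comm, hc] }
  let j : B →ₗ[K] S.A :=
    { toFun := fun z => ⟨⟨0, z⟩, rfl⟩
      map_add' := fun x y => Subtype.ext (by
        show (Dual.mk 0 (x + y) : Dual B) = Dual.mk 0 x + Dual.mk 0 y
        ext <;> simp)
      map_smul' := fun c x => Subtype.ext (by
        show (Dual.mk 0 (c • x) : Dual B) = c • Dual.mk 0 x
        ext <;> simp) }
  choose α hα using fun φ c hc => (hT S (Φ φ c hc)).exists
  have hl : ∀ b z, S.s b * S.k (j z) = S.k (j (b * z)) := fun b z =>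
    Subtype.ext (Prod.ext (mul_zero b) (by
      show (Dual.mk b 0 : Dual B) * Dual.mk 0 z = Dual.mk 0 (b * z)
      ext <;> simp))
  have hr : ∀ b z, S.k (j z) * S.s b = S.k (j (z * b)) := fun b z =>
    Subtype.ext (Prod.ext (zero_mul b) (by
      show (Dual.mk 0 z : Dual B) * Dual.mk b 0 = Dual.mk 0 (z * b)
      ext <;> simp))
  refine ⟨⟨T.G, T.A, T.s, T.k, T.k_injective, ε, fun φ c => if hc : c * c = 0 then
    ((α φ c hc).onKernel : S.A →ₗ[K] T.A) ∘ₗ j else 0, ?_, ?_, ?_⟩⟩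
  · intro φ c hc b z
    simp only [hc, dif_pos, LinearMap.comp_apply]
    show T.s b * T.k ((α φ c hc).onKernel (j z)) = T.k ((α φ c hc).onKernel (j (b * z)))
    rw [← SplitExt.Hom.comm_k, ← SplitExt.Hom.comm_k, ← (α φ c hc).comm_s, ← map_mul, hl]
  · intro φ c hc b z
    simp only [hc, dif_pos, LinearMap.comp_apply]
    show T.k ((α φ c hc).onKernel (j z)) * T.s b = T.k ((α φ c hc).onKernel (j (z * b)))
    rw [← SplitExt.Hom.comm_k, ← SplitExt.Hom.comm_k, ← (α φ c hc).comm_s, ← map_mul, hr]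
  · intro φ c hc z
    simp only [hc, dif_pos, LinearMap.comp_apply]
    exact hα φ c hc (j z)

end NAVariety

/-! ### Rewriting `b(xy)` through `bx` and `by` -/

namespace NAVariety

/-- The multiplication (for `false`) and the opposite multiplication (for `true`). -/
def op {A : Type*} [Mul A] : Bool → A → A → A
  | false, x, y => x * y
  | true, x, y => y * x

section Op

variable {A : Type*} [NonUnitalNonAssocRing A]

@[simp] theorem op_false (x y : A) : op false x y = x * y := rfl
@[simp] theorem op_true (x y : A) : op true x y = y * x := rfl

theorem op_not (p : Bool) (x y : A) : op (!p) x y = op p y x := by cases p <;> rfl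

theorem op_add (p : Bool) (x y z : A) : op p x (y + z) = op p x y + op p x z := by
  cases p <;> simp [mul_add, add_mul]
theorem add_op (p : Bool) (x y z : A) : op p (x + y) z = op p x z + op p y z := by
  cases p <;> simp [mul_add, add_mul]

theorem op_sum {ι : Type*} (s : Finset ι) (p : Bool) (x : A) (f : ι → A) :
    op p x (∑ i ∈ s, f i) = ∑ i ∈ s, op p x (f i) := by
  cases p <;> simp [Finset.mul_sum, Finset.sum_mul]

variable {K : Type*} [Field K] [Module K A]

theorem map_op {B : Type*} [NonUnitalNonAssocRing B] [Module K B] (f : A →ₙₐ[K] B) (p : Bool)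
    (x y : A) : f (op p x y) = op p (f x) (f y) := by
  cases p <;> simp

variable [IsScalarTower K A A] [SMulCommClass K A A]

theorem op_smul (p : Bool) (c : K) (x y : A) : op p x (c • y) = c • op p x y := by
  cases p <;> simp [smul_mul_assoc, mul_smul_comm]
theorem smul_op (p : Bool) (c : K) (x y : A) : op p (c • x) y = c • op p x y := by
  cases p <;> simp [smul_mul_assoc, mul_smul_comm]

variable (K) in
/-- `op` as a bilinear map. -/
def opₗ (p : Bool) : A →ₗ[K] A →ₗ[K] A :=
  LinearMap.mk₂ K (op p) (add_op p) (fun c x y => smul_op p c x y) (op_add p)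
    (fun c x y => op_smul p c x y)

@[simp] theorem opₗ_apply (p : Bool) (x y : A) : opₗ K p x y = op p x y := rfl

theorem op_mem_of_span {s t : Set A} {W : Submodule K A} (p : Bool)
    (h : ∀ x ∈ s, ∀ y ∈ t, op p x y ∈ W) {x y : A} (hx : x ∈ Submodule.span K s)
    (hy : y ∈ Submodule.span K t) : op p x y ∈ W := by
  have h₁ := Submodule.apply_mem_map₂ (opₗ K p) hx hy
  rw [Submodule.map₂_span_span] at h₁
  refine Submodule.span_le.2 ?_ h₁
  rintro _ ⟨x, hx, y, hy, rfl⟩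
  exact h x hx y hy

end Op

variable {K : Type u} [Field K] {V : NAVariety K}

/-- This is `HasCofree.mul_mem` in the triple dual numbers, with `ε₁`, `ε₂`, `ε₃` counted from the
inside: `B₀ = ε₁D`, `A₁ = ε₂X + ε₁ε₂X'` and `A₂ = ε₃Y + ε₁ε₃Y'`. The conclusion is read off at
`ε₁ε₂ε₃`. -/
theorem HasCofree.op_mem [Infinite K] (hV : V.HasCofree) {Ω : V.Obj}
    {D X X' Y Y' W : Submodule K Ω}
    (hX : ∀ p, ∀ d ∈ D, ∀ x ∈ X, op p d x ∈ X') (hY : ∀ p, ∀ d ∈ D, ∀ y ∈ Y, op p d y ∈ Y')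
    (hXY : ∀ p, ∀ x ∈ X, ∀ y ∈ Y', op p x y ∈ W) (hYX : ∀ p, ∀ x ∈ X', ∀ y ∈ Y, op p x y ∈ W)
    (p q : Bool) {d x y : Ω} (hd : d ∈ D) (hx : x ∈ X) (hy : y ∈ Y) : op p d (op q x y) ∈ W := by
  have hX₀ := fun d hd x hx => hX false d hd x hx
  have hX₁ := fun d hd x hx => hX true d hd x hx
  have hY₀ := fun d hd x hx => hY false d hd x hx
  have hY₁ := fun d hd x hx => hY true d hd x hx
  have hXY₀ := fun d hd x hx => hXY false d hd x hx
  have hXY₁ := fun d hd x hx => hXY true d hd x hx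
  have hYX₀ := fun d hd x hx => hYX false d hd x hx
  have hYX₁ := fun d hd x hx => hYX true d hd x hx
  simp only [op_false, op_true] at hX₀ hX₁ hY₀ hY₁ hXY₀ hXY₁ hYX₀ hYX₁
  let B₀ : NonUnitalSubalgebra K (Dual (Dual (Dual Ω))) :=
    { carrier := {h | h.im = 0 ∧ h.re.im = 0 ∧ h.re.re.re = 0 ∧ h.re.re.im ∈ D}
      zero_mem' := ⟨rfl, rfl, rfl, D.zero_mem⟩
      add_mem' := by
        rintro a b ⟨h₁, h₂, h₃, h₄⟩ ⟨h₁', h₂', h₃', h₄'⟩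
        exact ⟨by simp [h₁, h₁'], by simp [h₂, h₂'], by simp [h₃, h₃'], D.add_mem h₄ h₄'⟩
      smul_mem' := by
        rintro c a ⟨h₁, h₂, h₃, h₄⟩
        exact ⟨by simp [h₁], by simp [h₂], by simp [h₃], D.smul_mem c h₄⟩
      mul_mem' := by
        rintro a b ⟨h₁, h₂, h₃, h₄⟩ ⟨h₁', h₂', h₃', h₄'⟩
        exact ⟨by simp [h₁, h₁'], by simp [h₂, h₂'], by simp [h₃, h₃'], by simp [h₃, h₃']⟩ }
  let A₁ : NonUnitalSubalgebra K (Dual (Dual (Dual Ω))) :=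
    { carrier := {h | h.im = 0 ∧ h.re.re = 0 ∧ h.re.im.re ∈ X ∧ h.re.im.im ∈ X'}
      zero_mem' := ⟨rfl, rfl, X.zero_mem, X'.zero_mem⟩
      add_mem' := by
        rintro a b ⟨h₁, h₂, h₃, h₄⟩ ⟨h₁', h₂', h₃', h₄'⟩
        exact ⟨by simp [h₁, h₁'], by simp [h₂, h₂'], X.add_mem h₃ h₃', X'.add_mem h₄ h₄'⟩
      smul_mem' := by
        rintro c a ⟨h₁, h₂, h₃, h₄⟩
        exact ⟨by simp [h₁], by simp [h₂], X.smul_mem c h₃, X'.smul_mem c h₄⟩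
      mul_mem' := by
        rintro a b ⟨h₁, h₂, h₃, h₄⟩ ⟨h₁', h₂', h₃', h₄'⟩
        exact ⟨by simp [h₁, h₁'], by simp [h₂, h₂'], by simp [h₂, h₂'], by simp [h₂, h₂']⟩ }
  let A₂ : NonUnitalSubalgebra K (Dual (Dual (Dual Ω))) :=
    { carrier := {h | h.re = 0 ∧ h.im.im = 0 ∧ h.im.re.re ∈ Y ∧ h.im.re.im ∈ Y'}
      zero_mem' := ⟨rfl, rfl, Y.zero_mem, Y'.zero_mem⟩
      add_mem' := by
        rintro a b ⟨h₁, h₂, h₃, h₄⟩ ⟨h₁', h₂', h₃', h₄'⟩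
        exact ⟨by simp [h₁, h₁'], by simp [h₂, h₂'], Y.add_mem h₃ h₃', Y'.add_mem h₄ h₄'⟩
      smul_mem' := by
        rintro c a ⟨h₁, h₂, h₃, h₄⟩
        exact ⟨by simp [h₁], by simp [h₂], Y.smul_mem c h₃, Y'.smul_mem c h₄⟩
      mul_mem' := by
        rintro a b ⟨h₁, h₂, h₃, h₄⟩ ⟨h₁', h₂', h₃', h₄'⟩
        exact ⟨by simp [h₁], by simp [h₁, h₁'], by simp [h₁, h₁'], by simp [h₁, h₁']⟩ }
  -- The coefficient of `ε₂ε₃` is left free, so `C` contains `xy` without any constraint on it; only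
  -- the coefficient of `ε₁ε₂ε₃` is required to lie in `W`.
  let C : NonUnitalSubalgebra K (Dual (Dual (Dual Ω))) :=
    { carrier := {h | h.re.re = 0 ∧ h.re.im.re ∈ X ∧ h.re.im.im ∈ X' ∧ h.im.re.re ∈ Y ∧
        h.im.re.im ∈ Y' ∧ h.im.im.im ∈ W}
      zero_mem' := ⟨rfl, X.zero_mem, X'.zero_mem, Y.zero_mem, Y'.zero_mem, W.zero_mem⟩
      add_mem' := by
        rintro a b ⟨h₁, h₂, h₃, h₄, h₅, h₆⟩ ⟨h₁', h₂', h₃', h₄', h₅', h₆'⟩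
        exact ⟨by simp [h₁, h₁'], X.add_mem h₂ h₂', X'.add_mem h₃ h₃', Y.add_mem h₄ h₄',
          Y'.add_mem h₅ h₅', W.add_mem h₆ h₆'⟩
      smul_mem' := by
        rintro c a ⟨h₁, h₂, h₃, h₄, h₅, h₆⟩
        exact ⟨by simp [h₁], X.smul_mem c h₂, X'.smul_mem c h₃, Y.smul_mem c h₄,
          Y'.smul_mem c h₅, W.smul_mem c h₆⟩
      mul_mem' := by
        rintro a b ⟨h₁, h₂, h₃, h₄, h₅, h₆⟩ ⟨h₁', h₂', h₃', h₄', h₅', h₆'⟩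
        refine ⟨by simp [h₁], by simp [h₁, h₁'], by simp [h₁, h₁'], by simp [h₁, h₁'],
          by simp [h₁, h₁'], ?_⟩
        simp only [Dual.im_mul, Dual.im_add, h₁, h₁', zero_mul, mul_zero, zero_add, add_zero]
        exact W.add_mem (W.add_mem (hXY₀ _ h₂ _ h₅') (hYX₀ _ h₃ _ h₄'))
          (W.add_mem (hYX₁ _ h₃' _ h₄) (hXY₁ _ h₂' _ h₅)) }
  let ι : (Ω.dual.dual.dual.sub B₀) →ₙₐ[K] Dual (Dual (Dual Ω)) :=
    NonUnitalSubalgebraClass.subtype B₀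
  let x' : Dual (Dual (Dual Ω)) := ⟨⟨0, ⟨x, 0⟩⟩, 0⟩
  let y' : Dual (Dual (Dual Ω)) := ⟨0, ⟨⟨y, 0⟩, 0⟩⟩
  let d' : Ω.dual.dual.dual.sub B₀ := ⟨⟨⟨⟨0, d⟩, 0⟩, 0⟩, ⟨rfl, rfl, rfl, hd⟩⟩
  have hl₁ : ∀ b : Ω.dual.dual.dual.sub B₀, ∀ a ∈ A₁, ι b * a ∈ A₁ := by
    rintro ⟨b, b₁, b₂, b₃, b₄⟩ a ⟨h₁, h₂, h₃, h₄⟩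
    refine ⟨?_, ?_, ?_, ?_⟩ <;> simp [ι, b₁, b₂, b₃, h₁, h₂, hX₀ _ b₄ _ h₃]
  have hr₁ : ∀ b : Ω.dual.dual.dual.sub B₀, ∀ a ∈ A₁, a * ι b ∈ A₁ := by
    rintro ⟨b, b₁, b₂, b₃, b₄⟩ a ⟨h₁, h₂, h₃, h₄⟩
    refine ⟨?_, ?_, ?_, ?_⟩ <;> simp [ι, b₁, b₂, b₃, h₁, h₂, hX₁ _ b₄ _ h₃]
  have hl₂ : ∀ b : Ω.dual.dual.dual.sub B₀, ∀ a ∈ A₂, ι b * a ∈ A₂ := by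
    rintro ⟨b, b₁, b₂, b₃, b₄⟩ a ⟨h₁, h₂, h₃, h₄⟩
    refine ⟨?_, ?_, ?_, ?_⟩ <;> simp [ι, b₁, b₂, b₃, h₁, h₂, hY₀ _ b₄ _ h₃]
  have hr₂ : ∀ b : Ω.dual.dual.dual.sub B₀, ∀ a ∈ A₂, a * ι b ∈ A₂ := by
    rintro ⟨b, b₁, b₂, b₃, b₄⟩ a ⟨h₁, h₂, h₃, h₄⟩
    refine ⟨?_, ?_, ?_, ?_⟩ <;> simp [ι, b₁, b₂, b₃, h₁, h₂, hY₁ _ b₄ _ h₃]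
  have h₁ : A₁ ≤ C := by
    rintro a ⟨h₁, h₂, h₃, h₄⟩
    exact ⟨h₂, h₃, h₄, by simp [h₁], by simp [h₁], by simp [h₁]⟩
  have h₂ : A₂ ≤ C := by
    rintro a ⟨h₁, h₂, h₃, h₄⟩
    exact ⟨by simp [h₁], by simp [h₁], by simp [h₁], h₃, h₄, by simp [h₂]⟩
  have hx' : x' ∈ A₁ := ⟨rfl, rfl, hx, X'.zero_mem⟩
  have hy' : y' ∈ A₂ := ⟨rfl, rfl, hy, Y'.zero_mem⟩
  have r₁ := hV.mul_mem (H := Ω.dual.dual.dual) ι hl₁ hr₁ hl₂ hr₂ h₁ h₂ d' hx' hy'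
  have r₂ := hV.mul_mem (H := Ω.dual.dual.dual) ι hl₂ hr₂ hl₁ hr₁ h₂ h₁ d' hy' hx'
  have e₁ : d * (x * y) ∈ W ∧ x * y * d ∈ W := by
    have := And.intro r₁.1.2.2.2.2.2 r₁.2.2.2.2.2.2
    simpa [ι, d', x', y'] using this
  have e₂ : d * (y * x) ∈ W ∧ y * x * d ∈ W := by
    have := And.intro r₂.1.2.2.2.2.2 r₂.2.2.2.2.2.2
    simpa [ι, d', x', y'] using this
  cases p <;> cases q
  exacts [e₁.1, e₂.1, e₁.2, e₂.2]

/-- Multiplication by an element acts on products through its action on the factors. -/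
theorem HasCofree.exists_rewrite [Infinite K] (hV : V.HasCofree) :
    ∃ θ β : Bool → Bool → Bool → Bool → K, ∀ (A : V.Obj) (p q : Bool) (b x y : A),
      op p b (op q x y) = ∑ k, ∑ l, (θ p q k l • op l (op k b x) y + β p q k l • op l (op k b y) x)
      := by
  obtain ⟨Ω, ξ, hξ⟩ := V.exists_generic
  let mon : Bool × Bool × Bool → Ω := fun i =>
    cond i.1 (op i.2.2 (op i.2.1 (ξ 0) (ξ 2)) (ξ 1)) (op i.2.2 (op i.2.1 (ξ 0) (ξ 1)) (ξ 2))
  -- For generic elements, `X'` and `Y'` can be taken to be the spans of the two products with `b`;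
  -- the coefficients found there hold in every algebra of `V`.
  have key : ∀ p q, op p (ξ 0) (op q (ξ 1) (ξ 2)) ∈ Submodule.span K (Set.range mon) := by
    intro p q
    refine hV.op_mem (D := K ∙ ξ 0) (X := K ∙ ξ 1) (Y := K ∙ ξ 2)
      (X' := Submodule.span K (Set.range fun k => op k (ξ 0) (ξ 1)))
      (Y' := Submodule.span K (Set.range fun k => op k (ξ 0) (ξ 2))) ?_ ?_ ?_ ?_ p q
      (Submodule.mem_span_singleton_self _) (Submodule.mem_span_singleton_self _)
      (Submodule.mem_span_singleton_self _)
    · refine fun p d hd x hx => op_mem_of_span p ?_ hd hx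
      rintro _ rfl _ rfl
      exact Submodule.subset_span ⟨p, rfl⟩
    · refine fun p d hd x hx => op_mem_of_span p ?_ hd hx
      rintro _ rfl _ rfl
      exact Submodule.subset_span ⟨p, rfl⟩
    · refine fun p x hx y hy => op_mem_of_span p ?_ hx hy
      rintro _ rfl _ ⟨k, rfl⟩
      exact Submodule.subset_span ⟨(true, k, !p), by simp [mon, op_not]⟩
    · refine fun p x hx y hy => op_mem_of_span p ?_ hx hy
      rintro _ ⟨k, rfl⟩ _ rfl
      exact Submodule.subset_span ⟨(false, k, p), by simp [mon]⟩
  simp only [Submodule.mem_span_range_iff_exists_fun] at key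
  choose c hc using key
  refine ⟨fun p q k l => c p q (false, k, l), fun p q k l => c p q (true, k, l),
    fun A p q b x y => ?_⟩
  let v : ℕ → A := fun n => match n with
    | 0 => b
    | 1 => x
    | _ => y
  let P : FreeNonUnitalNonAssocAlgebra K ℕ := op p (X K 0) (op q (X K 1) (X K 2)) -
    ∑ k, ∑ l, (c p q (false, k, l) • op l (op k (X K 0) (X K 1)) (X K 2) +
      c p q (true, k, l) • op l (op k (X K 0) (X K 2)) (X K 1))
  have hX : ∀ (A : V.Obj) (w : ℕ → A) i, FreeNonUnitalNonAssocAlgebra.lift K w (X K i) = w i :=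
    fun A w i => FreeNonUnitalNonAssocAlgebra.lift_of_apply K w i
  have hP : FreeNonUnitalNonAssocAlgebra.lift K ξ P = 0 := by
    simp only [P, map_sub, map_sum, map_add, map_smul, map_op, hX, sub_eq_zero]
    rw [← hc p q]
    simp only [Fintype.sum_prod_type, Fintype.sum_bool, mon, cond_true, cond_false]
    abel
  have := hξ P hP A v
  simp only [P, map_sub, map_sum, map_add, map_smul, map_op, hX, sub_eq_zero] at this
  exact this

end NAVariety

/-! ### Test modules with prescribed products -/

namespace NAVariety

variable {K : Type u} [Field K] {V : NAVariety K}

/-- Elements on which an object acts in a prescribed way, with prescribed products. -/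
theorem HasCofree.exists_pairing [Infinite K] (hV : V.HasCofree) (B A₀ : V.Obj) (a a' : A₀)
    (φ ψ : B →ₗ[K] K) : ∃ (G : V.Obj) (s : B →ₙₐ[K] G) (X Y : B →ₗ[K] G) (E : G →ₗ[K] A₀),
      (∀ p b z, op p (s b) (X z) = X (op p b z)) ∧ (∀ p b z, op p (s b) (Y z) = Y (op p b z)) ∧
      ∀ l z₁ z₂, E (op l (X z₁) (Y z₂)) = (φ z₁ * ψ z₂) • op l a a' := by
  obtain ⟨W⟩ := hV.nonempty_wreath B A₀.dual.dual
  -- The elements `a` and `a'` are multiplied by different infinitesimals, so both squares vanish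
  -- while `aa'` and `a'a` survive as coefficients of the product of the infinitesimals.
  let c : Dual (Dual A₀) := ⟨⟨0, a⟩, 0⟩
  let d : Dual (Dual A₀) := ⟨0, ⟨a', 0⟩⟩
  have hc : c * c = 0 := by ext <;> simp [c]
  have hd : d * d = 0 := by ext <;> simp [d]
  obtain ⟨r, hr⟩ := LinearMap.exists_leftInverse_of_injective
    ({ W.k with map_smul' := fun c x => map_smul W.k c x } : W.A →ₗ[K] W.G)
    (LinearMap.ker_eq_bot.2 W.k_injective)
  have hr' : ∀ x, r (W.k x) = x := fun x => LinearMap.congr_fun hr x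
  let kₗ : W.A →ₗ[K] W.G := { W.k with map_smul' := fun c x => map_smul W.k c x }
  let εₗ : W.A →ₗ[K] Dual (Dual A₀) := { W.ε with map_smul' := fun c x => map_smul W.ε c x }
  refine ⟨W.G, W.s, kₗ.comp (W.α φ c), kₗ.comp (W.α ψ d),
    Dual.imₗ.comp (Dual.imₗ.comp (εₗ.comp r)), ?_, ?_, ?_⟩
  · intro p b z
    cases p
    exacts [W.s_mul φ c hc b z, W.mul_s φ c hc b z]
  · intro p b z
    cases p
    exacts [W.s_mul ψ d hd b z, W.mul_s ψ d hd b z]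
  · intro l z₁ z₂
    have h₁ : ∀ z, W.ε (W.α φ c z) = φ z • c := W.ε_α φ c hc
    have h₂ : ∀ z, W.ε (W.α ψ d z) = ψ z • d := W.ε_α ψ d hd
    show (W.ε (r (op l (W.k (W.α φ c z₁)) (W.k (W.α ψ d z₂))))).im.im = _
    rw [← map_op, hr', map_op, h₁, h₂]
    cases l <;> simp [c, d, smul_smul, smul_mul_assoc, mul_smul_comm, mul_comm]

/-- If a variety is neither commutative nor anticommutative, then it contains elements whose
two products are linearly independent. -/
theorem exists_independent (h₁ : ¬ ∀ (A : V.Obj) (x y : A), x * y = y * x)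
    (h₂ : ¬ V.IsAnticommutative) :
    ∃ (A : V.Obj) (a a' : A) (f : Bool → A →ₗ[K] K),
      ∀ l m, f l (op m a a') = if l = m then 1 else 0 := by
  simp only [IsAnticommutative, not_forall] at h₁ h₂
  obtain ⟨A₁, x₁, y₁, h₁⟩ := h₁
  obtain ⟨A₂, x₂, y₂, h₂⟩ := h₂
  -- The pair violating commutativity and the pair violating anticommutativity each occur in both
  -- orders. A relation between the two products then has coefficients with zero difference and zero
  -- sum; equality of the coefficients finishes this even in characteristic two.
  let A : V.Obj := (A₁.prod A₁).prod (A₂.prod A₂)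
  let a : A := ((x₁, y₁), (x₂, y₂))
  let a' : A := ((y₁, x₁), (y₂, x₂))
  have key : LinearIndependent K fun m => op m a a' := by
    rw [Fintype.linearIndependent_iff]
    intro g hg
    rw [Fintype.sum_bool] at hg
    have e₁ := congrArg (fun z => z.1.1) hg
    have e₂ := congrArg (fun z => z.1.2) hg
    have e₃ := congrArg (fun z => z.2.1) hg
    have e₄ := congrArg (fun z => z.2.2) hg
    change g true • (y₁ * x₁) + g false • (x₁ * y₁) = 0 at e₁
    change g true • (x₁ * y₁) + g false • (y₁ * x₁) = 0 at e₂
    change g true • (y₂ * x₂) + g false • (x₂ * y₂) = 0 at e₃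
    change g true • (x₂ * y₂) + g false • (y₂ * x₂) = 0 at e₄
    have h₃ : (g true - g false) • (x₁ * y₁ - y₁ * x₁) = 0 := by
      calc _ = (g true • (x₁ * y₁) + g false • (y₁ * x₁)) -
            (g true • (y₁ * x₁) + g false • (x₁ * y₁)) := by module
        _ = 0 := by rw [e₁, e₂, sub_zero]
    have h₄ : (g true + g false) • (x₂ * y₂ + y₂ * x₂) = 0 := by
      calc _ = (g true • (y₂ * x₂) + g false • (x₂ * y₂)) +
            (g true • (x₂ * y₂) + g false • (y₂ * x₂)) := by module
        _ = 0 := by rw [e₃, e₄, add_zero]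
    have h₅ := (smul_eq_zero.1 h₃).resolve_right (sub_ne_zero.2 h₁)
    have h₆ := (smul_eq_zero.1 h₄).resolve_right (fun h => h₂ (eq_neg_of_add_eq_zero_left h))
    have h₇ : g true = g false := sub_eq_zero.1 h₅
    rw [h₇, ← smul_add] at e₁
    rw [h₇, ← smul_add] at e₃
    have h₈ : g false = 0 := by
      refine (smul_eq_zero.1 e₃).resolve_right fun h => h₂ ?_
      rw [add_comm] at h
      exact eq_neg_of_add_eq_zero_left h
    intro i
    cases i
    exacts [h₈, h₇.trans h₈]
  refine ⟨A, a, a', fun l => ?_, ?_⟩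
  · exact (Classical.choose (LinearMap.exists_extend (Finsupp.lapply l ∘ₗ key.repr)))
  · intro l m
    have := Classical.choose_spec (LinearMap.exists_extend (Finsupp.lapply l ∘ₗ key.repr))
    have h := LinearMap.congr_fun this ⟨op m a a', Submodule.subset_span ⟨m, rfl⟩⟩
    refine Eq.trans h ?_
    have e : (key.repr ⟨op m a a', Submodule.subset_span ⟨m, rfl⟩⟩) = Finsupp.single m 1 :=
      key.repr_eq_single m _ rfl
    refine (congrArg (fun z => z l) e).trans ?_
    simp [Finsupp.single_apply, eq_comm]

end NAVariety

/-! ### Independence of monomials and the rotation matrix -/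

namespace NAVariety

theorem exists_dual_eq_one (K : Type*) {M : Type*} [Field K] [AddCommGroup M] [Module K M] {x : M}
    (hx : x ≠ 0) : ∃ g : M →ₗ[K] K, g x = 1 := by
  have h := mt (Module.forall_dual_apply_eq_zero_iff K x).1 hx
  push Not at h
  obtain ⟨g, hg⟩ := h
  exact ⟨(g x)⁻¹ • g, inv_mul_cancel₀ hg⟩

variable {K : Type u} [Field K] {V : NAVariety K}

/-- The monomials `(bx)y`, `(by)x` and their opposites are linearly independent. -/
theorem HasCofree.monomials_independent [Infinite K] (hV : V.HasCofree) {A₀ : V.Obj} {a a' : A₀}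
    {f : Bool → A₀ →ₗ[K] K} (hf : ∀ l m, f l (op m a a') = if l = m then 1 else 0)
    (c d : Bool → Bool → K)
    (h : ∀ (A : V.Obj) (b x y : A),
      ∑ k, ∑ l, (c k l • op l (op k b x) y + d k l • op l (op k b y) x) = 0) :
    c = 0 := by
  have ha' : a' ≠ 0 := by
    rintro rfl
    simpa using hf true true
  obtain ⟨g, hg⟩ := exists_dual_eq_one K ha'
  ext k₀ l₀
  -- With `b = aε` and `x = y = a'`, the first functional sees only `bx` and the second only `y`.
  -- This kills every term with `by` and isolates the coefficient `c k₀ l₀`.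
  obtain ⟨G, s, X, Y, E, hX, hY, hE⟩ := hV.exists_pairing A₀.dual A₀ a a' (f k₀ ∘ₗ Dual.imₗ)
    (g ∘ₗ Dual.reₗ)
  have h₁ := congrArg (fun z => f l₀ (E z)) (h G (s ⟨0, a⟩) (X ⟨a', 0⟩) (Y ⟨a', 0⟩))
  have hop : ∀ k, op k (⟨0, a⟩ : Dual A₀) ⟨a', 0⟩ = ⟨0, op k a a'⟩ := by
    intro k
    cases k <;> ext <;> simp
  have h₂ : ∀ l z₁ z₂, op l (Y z₂) (X z₁) = op (!l) (X z₁) (Y z₂) := fun l z₁ z₂ =>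
    (op_not _ _ _).symm
  simp only [hX, hY, h₂, map_sum, map_add, map_smul, hE, hop, map_zero] at h₁
  simpa [hf, hg] using h₁

/-- The rewriting rule of `HasCofree.exists_rewrite` for two linearly independent products. -/
theorem HasCofree.exists_symmetric_rewrite [Infinite K] (hV : V.HasCofree) {A₀ : V.Obj}
    {a a' : A₀} {f : Bool → A₀ →ₗ[K] K} (hf : ∀ l m, f l (op m a a') = if l = m then 1 else 0) :
    ∃ θ : Bool → Bool → Bool → Bool → K, ∀ (A : V.Obj) (p q : Bool) (b x y : A),
      op p b (op q x y) =
        ∑ k, ∑ l, (θ p q k l • op l (op k b x) y + θ p (!q) k l • op l (op k b y) x) := by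
  obtain ⟨θ, β, h⟩ := hV.exists_rewrite
  refine ⟨θ, fun A p q b x y => ?_⟩
  -- Reversing the inner product amounts to exchanging `x` and `y`; the two resulting expansions are
  -- compared coefficientwise.
  have key : β p q = θ p (!q) := by
    have := hV.monomials_independent hf (fun k l => β p q k l - θ p (!q) k l)
      (fun k l => θ p q k l - β p (!q) k l) fun A b x y => ?_
    · ext k l
      exact sub_eq_zero.1 (congrFun (congrFun this k) l)
    · have h₁ := h A p (!q) b x y
      rw [op_not, h A p q b y x] at h₁
      rw [← sub_eq_zero, ← Finset.sum_sub_distrib] at h₁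
      rw [← h₁]
      refine Finset.sum_congr rfl fun k _ => ?_
      rw [← Finset.sum_sub_distrib]
      refine Finset.sum_congr rfl fun l _ => ?_
      module
  rw [h, key]

/-- The matrix that expresses the rewriting rule as a rotation of the three variables. -/
def rotation (θ : Bool → Bool → Bool → Bool → K) : Matrix (Bool × Bool) (Bool × Bool) K :=
  Matrix.of fun i j => -θ j.1 j.2 i.2 (!i.1)

/-- The matrix of the transposition of the two inner variables. -/
def transposition (K : Type*) [Field K] : Matrix (Bool × Bool) (Bool × Bool) K :=
  Matrix.of fun i j => if i = (j.1, !j.2) then 1 else 0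

theorem transposition_mulVec (v : Bool × Bool → K) :
    (transposition K).mulVec v = fun i => v (i.1, !i.2) := by
  ext ⟨i, j⟩
  cases i <;> cases j <;>
  simp [Matrix.mulVec, dotProduct, transposition, Fintype.sum_prod_type]

theorem rotation_mulVec (θ : Bool → Bool → Bool → Bool → K) (v : Bool × Bool → K) (i : Bool × Bool) :
    (rotation θ).mulVec v i = -∑ p, ∑ q, v (p, q) * θ p q i.2 (!i.1) := by
  simp [Matrix.mulVec, dotProduct, rotation, Fintype.sum_prod_type, mul_comm]

/-- A linear combination of the four monomials in which `b` is multiplied with a product of `x`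
and `y`. -/
def outer {A : V.Obj} (v : Bool × Bool → K) (b x y : A) : A :=
  ∑ p, ∑ q, v (p, q) • op p b (op q x y)

/-- A product of `bx` with `y` is an outer monomial for the rotated variables `y, b, x`, and
likewise for `by` and `x`. Thus three outer combinations cancel when `v₁ = Rv` and `v₂ = TRTv`. -/
theorem outer_sum {A : V.Obj} {θ : Bool → Bool → Bool → Bool → K} {b x y : A}
    (h : ∀ p q, op p b (op q x y) =
        ∑ k, ∑ l, (θ p q k l • op l (op k b x) y + θ p (!q) k l • op l (op k b y) x))
    (v v₁ v₂ : Bool × Bool → K) : outer v b x y + outer v₁ y b x + outer v₂ x y b =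
      ∑ k, ∑ l, ((v₁ - (rotation θ).mulVec v) (!l, k) • op l (op k b x) y +
        (v₂ - (transposition K).mulVec ((rotation θ).mulVec ((transposition K).mulVec v)))
          (!l, !k) • op l (op k b y) x) := by
  simp only [outer, h, transposition_mulVec, rotation_mulVec, Pi.sub_apply, Fintype.sum_bool,
    Bool.not_true, Bool.not_false, op_true, op_false]
  module

/-- An identity of the three-term form determines `v₁ = Rv` by independence of monomials. Cyclically
permuting the variables permutes the three coefficient vectors, which yields `TRTv = R²v` and `R³v =
v`. -/
theorem HasCofree.rotation_eq [Infinite K] (hV : V.HasCofree) {A₀ : V.Obj} {a a' : A₀}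
    {f : Bool → A₀ →ₗ[K] K} (hf : ∀ l m, f l (op m a a') = if l = m then 1 else 0)
    {θ : Bool → Bool → Bool → Bool → K} (h : ∀ (A : V.Obj) (p q : Bool) (b x y : A),
      op p b (op q x y) =
        ∑ k, ∑ l, (θ p q k l • op l (op k b x) y + θ p (!q) k l • op l (op k b y) x)) :
    transposition K * rotation θ * transposition K = rotation θ * rotation θ ∧
      rotation θ * rotation θ * rotation θ = 1 := by
  have key : ∀ v v₁ v₂, (∀ (A : V.Obj) (b x y : A),
      outer v b x y + outer v₁ y b x + outer v₂ x y b = 0) → v₁ = (rotation θ).mulVec v := by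
    intro v v₁ v₂ h₀
    have := hV.monomials_independent hf _ _ fun A b x y =>
      (outer_sum (fun p q => h A p q b x y) v v₁ v₂).symm.trans (h₀ A b x y)
    ext ⟨i, j⟩
    have h₁ := congrFun (congrFun this j) (!i)
    simpa [sub_eq_zero] using h₁
  have main : ∀ v, (rotation θ).mulVec ((rotation θ).mulVec v) = (transposition K).mulVec
      ((rotation θ).mulVec ((transposition K).mulVec v)) ∧ v = (rotation θ).mulVec
        ((rotation θ).mulVec ((rotation θ).mulVec v)) := by
    intro v
    set w := (transposition K).mulVec ((rotation θ).mulVec ((transposition K).mulVec v)) with hw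
    have h₀ : ∀ (A : V.Obj) (b x y : A),
        outer v b x y + outer ((rotation θ).mulVec v) y b x + outer w x y b = 0 := by
      intro A b x y
      rw [outer_sum (fun p q => h A p q b x y)]
      simp [hw]
    have h₁ : w = (rotation θ).mulVec ((rotation θ).mulVec v) := by
      refine key _ _ v fun A b x y => ?_
      rw [← h₀ A x y b]
      abel
    have h₂ : v = (rotation θ).mulVec w := by
      refine key _ _ ((rotation θ).mulVec v) fun A b x y => ?_
      rw [← h₀ A y b x]
      abel
    rw [← h₁]
    exact ⟨rfl, h₂⟩
  constructor
  · refine Matrix.ext_of_mulVec_single fun i => ?_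
    simp only [← Matrix.mulVec_mulVec, (main _).1]
  · refine Matrix.ext_of_mulVec_single fun i => ?_
    simp only [← Matrix.mulVec_mulVec, ← (main _).2, Matrix.one_mulVec]

end NAVariety

/-! ### A quadratic relation between the coefficients -/

namespace NAVariety

variable {K : Type u} [Field K] {V : NAVariety K}

/-- An iterated product of `b'` with the product of `b` and `P = XY` is computed in two ways: by
letting `b` and `b'` act on the factors in turn, and by applying the rewriting rule to `b'` and the
product of `b` with `P`. Here `b` and `b'` carry different infinitesimals, and the functionals
require `b` to hit `X` and `b'` to hit `Y`. -/
theorem HasCofree.cross_relation [Infinite K] (hV : V.HasCofree) {A₀ : V.Obj} {a a' : A₀}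
    {f : Bool → A₀ →ₗ[K] K} (hf : ∀ l m, f l (op m a a') = if l = m then 1 else 0)
    {θ : Bool → Bool → Bool → Bool → K} (h : ∀ (A : V.Obj) (p q : Bool) (b x y : A),
      op p b (op q x y) =
        ∑ k, ∑ l, (θ p q k l • op l (op k b x) y + θ p (!q) k l • op l (op k b y) x))
    (p p' m i j k : Bool) :
    ∑ l, θ p m i l * θ p' (!l) j (!k) =
      ∑ r, ∑ q, ∑ l, θ p' (!p) r (!q) * θ r (!m) j (!l) * θ q l i k := by
  obtain ⟨G, s, X, Y, E, hX, hY, hE⟩ := hV.exists_pairing A₀.dual.dual A₀ a a'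
    (f i ∘ₗ Dual.imₗ ∘ₗ Dual.reₗ) (f j ∘ₗ Dual.reₗ ∘ₗ Dual.imₗ)
  set φ : Dual (Dual A₀) →ₗ[K] K := f i ∘ₗ Dual.imₗ ∘ₗ Dual.reₗ with hφ
  set ψ : Dual (Dual A₀) →ₗ[K] K := f j ∘ₗ Dual.reₗ ∘ₗ Dual.imₗ with hψ
  let P : Bool → Dual (Dual A₀) → Dual (Dual A₀) → G := fun l z₁ z₂ => op l (X z₁) (Y z₂)
  have hP : ∀ l z₁ z₂, f k (E (P l z₁ z₂)) = φ z₁ * ψ z₂ * if k = l then 1 else 0 := by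
    intro l z₁ z₂
    rw [hE, map_smul, hf, smul_eq_mul]
  have hD : ∀ p m (γ z₁ z₂ : Dual (Dual A₀)), op p (s γ) (P m z₁ z₂) =
      ∑ k, ∑ l, (θ p m k l • P l (op k γ z₁) z₂ + θ p (!m) k (!l) • P l z₁ (op k γ z₂)) := by
    intro p m γ z₁ z₂
    simp only [P, h G p m (s γ), hX, hY]
    simp only [Fintype.sum_bool, op_true, op_false, Bool.not_true, Bool.not_false]
    abel
  let x : Dual (Dual A₀) := ⟨⟨a', 0⟩, 0⟩
  let b : Dual (Dual A₀) := ⟨⟨0, a⟩, 0⟩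
  let b' : Dual (Dual A₀) := ⟨0, ⟨a, 0⟩⟩
  have e₁ : φ x = 0 := by simp [φ, x]
  have e₂ : ψ x = 0 := by simp [ψ, x]
  have e₃ : ∀ k, φ (op k b x) = if i = k then 1 else 0 := by
    intro k
    rw [← hf]
    cases k <;> simp [φ, b, x]
  have e₄ : ∀ k, ψ (op k b x) = 0 := by
    intro k
    cases k <;> simp [ψ, b, x]
  have e₅ : ∀ k, φ (op k b' x) = 0 := by
    intro k
    cases k <;> simp [φ, b', x]
  have e₆ : ∀ k, ψ (op k b' x) = if j = k then 1 else 0 := by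
    intro k
    rw [← hf]
    cases k <;> simp [ψ, b', x]
  have h₁ : f k (E (op p' (s b') (op p (s b) (P m x x)))) = ∑ l, θ p m i l * θ p' (!l) j (!k) := by
    simp only [hD, op_sum, op_add, op_smul, map_sum, map_add, map_smul, hP, e₁, e₂, e₃, e₄, e₅, e₆]
    simp [Finset.sum_ite_eq, eq_comm]
  -- A single element moves only one factor, and the functional on the other factor kills `x`. So
  -- the terms of the rewriting rule containing `b'b` or `bb'` drop out.
  have h₂ : ∀ r z, f k (E (op r (s z) (P m x x))) = 0 := by
    intro r z
    simp only [hD, map_sum, map_add, map_smul, hP, e₁, e₂]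
    simp
  have h₃ : ∀ q r, f k (E (op q (s b) (op r (s b') (P m x x)))) =
      ∑ l, θ r (!m) j (!l) * θ q l i k := by
    intro q r
    simp only [hD, op_sum, op_add, op_smul, map_sum, map_add, map_smul, hP, e₁, e₂, e₃, e₄, e₅, e₆]
    simp
  rw [← h₁, h G p' p (s b') (s b)]
  have h₄ : ∀ q r, op q (op r (s b') (P m x x)) (s b) = op (!q) (s b) (op r (s b') (P m x x)) :=
    fun q r => (op_not _ _ _).symm
  have h₅ : ∀ r, op r (s b') (s b) = s (op r b' b) := fun r => (map_op s _ _ _).symm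
  simp only [h₄, h₅, map_sum, map_add, map_smul, h₂, h₃]
  simp only [Fintype.sum_bool, Bool.not_true, Bool.not_false, smul_eq_mul]
  ring

end NAVariety

/-! ### Multiplicatively closed spaces of 2 by 2 matrices -/

namespace NAVariety

section Transitive

variable {F E : Type*} [Field F] [AddCommGroup E] [Module F E]

/-- Burnside's theorem in dimension two. -/
theorem exists_common_eigenvector [IsAlgClosed F] (hE : Module.finrank F E = 2)
    (D : Submodule F (Module.End F E)) (hD : ∀ x ∈ D, ∀ y ∈ D, x * y ∈ D) (hne : D ≠ ⊤) :
    ∃ v : E, v ≠ 0 ∧ ∀ x ∈ D, ∃ c : F, x v = c • v := by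
  have : FiniteDimensional F E := Module.finite_of_finrank_pos (by omega)
  have : Nontrivial E := Module.nontrivial_of_finrank_pos (R := F) (by omega)
  by_contra! hcon
  -- Otherwise `Dv` is at most a line, stable under `D`; a nonzero vector on it would be a common
  -- eigenvector.
  have trans : ∀ v : E, v ≠ 0 → ∀ u, ∃ x ∈ D, x v = u := by
    intro v hv
    by_contra! hu
    let N : Submodule F E := D.map (LinearMap.applyₗ v)
    have hN : N ≠ ⊤ := by
      intro hN
      obtain ⟨u, hu⟩ := hu
      have : u ∈ N := hN ▸ Submodule.mem_top
      obtain ⟨x, hx, hxu⟩ := this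
      exact hu x hx hxu
    have hlt := Submodule.finrank_lt (lt_top_iff_ne_top.2 hN).ne
    obtain ⟨w, hw⟩ := finrank_le_one_iff.1 (show Module.finrank F N ≤ 1 by omega)
    obtain ⟨x₀, hx₀, h₀⟩ := hcon v hv
    have hz : x₀ v ≠ 0 := by simpa using h₀ 0
    obtain ⟨y, hy, hyc⟩ := hcon _ hz
    obtain ⟨c, hc⟩ := hw ⟨x₀ v, x₀, hx₀, rfl⟩
    obtain ⟨d, hd⟩ := hw ⟨y (x₀ v), y * x₀, hD _ hy _ hx₀, rfl⟩
    have hc' : c • (w : E) = x₀ v := congrArg Subtype.val hc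
    have hd' : d • (w : E) = y (x₀ v) := congrArg Subtype.val hd
    have hc0 : c ≠ 0 := by
      rintro rfl
      exact hz (by rw [← hc', zero_smul])
    apply hyc (d * c⁻¹)
    rw [← hc', smul_smul, mul_assoc, inv_mul_cancel₀ hc0, mul_one, hd', hc']
  -- A rank one element is wanted. The space `D` need not contain the identity, so `x(x - μ)` is
  -- used in place of `x - μ`; if it vanishes, `x` itself is singular.
  obtain ⟨z, hzD, v, v', hv, hzv, hzv'⟩ : ∃ z ∈ D, ∃ v v' : E, v ≠ 0 ∧ z v = 0 ∧ z v' ≠ 0 := by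
    obtain ⟨v₀, hv₀⟩ := exists_ne (0 : E)
    obtain ⟨x, hx, hxv⟩ := hcon v₀ hv₀
    have hx0 : x v₀ ≠ 0 := by simpa using hxv 0
    obtain ⟨μ, hμ⟩ := Module.End.exists_eigenvalue x
    obtain ⟨v, hv⟩ := hμ.exists_hasEigenvector
    by_cases hy : ∀ u, x (x u - μ • u) = 0
    · exact ⟨x, hx, x v₀ - μ • v₀, v₀, sub_ne_zero.2 (hxv μ), hy v₀, hx0⟩
    · push Not at hy
      obtain ⟨u, hu⟩ := hy
      refine ⟨x * x - μ • x, D.sub_mem (hD _ hx _ hx) (D.smul_mem _ hx), v, u, hv.2, ?_, ?_⟩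
      · have := hv.apply_eq_smul
        simp [this]
      · simpa using hu
  have hli : LinearIndependent F ![v, v'] := by
    rw [LinearIndependent.pair_iff]
    intro s t hst
    have h₁ := congrArg z hst
    simp only [map_add, map_smul, hzv, smul_zero, zero_add, map_zero] at h₁
    have ht := (smul_eq_zero.1 h₁).resolve_right hzv'
    rw [ht, zero_smul, add_zero] at hst
    exact ⟨(smul_eq_zero.1 hst).resolve_right hv, ht⟩
  let e := basisOfLinearIndependentOfCardEqFinrank hli (by simp [hE])
  have e₀ : e 0 = v := by simp [e]
  have e₁ : e 1 = v' := by simp [e]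
  have hker : ∀ u, ∃ y ∈ D, y v = 0 ∧ y v' = u := by
    intro u
    obtain ⟨x, hx, hxu⟩ := trans _ hzv' u
    exact ⟨x * z, hD _ hx _ hzD, by simp [hzv], by simp [hxu]⟩
  have hker' : ∀ u, ∃ y ∈ D, y v = u ∧ y v' = 0 := by
    intro u
    obtain ⟨y, hy, h₁, h₂⟩ := hker u
    obtain ⟨t, ht, htv⟩ := trans v hv v'
    obtain ⟨α, β, h₃⟩ : ∃ α β : F, t v' = α • v + β • v' := by
      refine ⟨e.repr (t v') 0, e.repr (t v') 1, ?_⟩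
      conv_lhs => rw [← e.sum_repr (t v')]
      simp only [Fin.sum_univ_two, e₀, e₁]
    refine ⟨y * t - β • y, D.sub_mem (hD _ hy _ ht) (D.smul_mem _ hy), ?_, ?_⟩
    · simp [htv, h₁, h₂]
    · rw [LinearMap.sub_apply, Module.End.mul_apply, h₃]
      simp [h₁, h₂]
  refine hne (Submodule.eq_top_iff'.2 fun x => ?_)
  obtain ⟨y, hy, h₁, h₂⟩ := hker (x v')
  obtain ⟨y', hy', h₁', h₂'⟩ := hker' (x v)
  have : x = y + y' := by
    refine e.ext fun i => ?_
    fin_cases i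
    · simp [e₀, h₁, h₁']
    · simp [e₁, h₂, h₂']
  rw [this]
  exact D.add_mem hy hy'

end Transitive

/-- The off-diagonal matrix units square to zero, so `f` kills them, and the diagonal ones are
products of these. -/
theorem not_multiplicative {F : Type*} [Field F] (f : Matrix Bool Bool F →ₗ[F] F)
    (hf : ∀ x y, f (x * y) = f x * f y) : f = 0 := by
  have h₁ : ∀ i, f (Matrix.single i (!i) 1) = 0 := by
    intro i
    have h := hf (Matrix.single i (!i) 1) (Matrix.single i (!i) 1)
    rw [Matrix.single_mul_single_of_ne _ _ _ _ (by simp), map_zero] at h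
    exact mul_self_eq_zero.1 h.symm
  have h₂ : ∀ i, f (Matrix.single i i 1) = 0 := by
    intro i
    have h := hf (Matrix.single i (!i) 1) (Matrix.single (!i) i 1)
    rw [Matrix.single_mul_single_same, mul_one, h₁, zero_mul] at h
    exact h
  refine (Matrix.stdBasis F Bool Bool).ext fun ⟨i, j⟩ => ?_
  rw [Matrix.stdBasis_eq_single, LinearMap.zero_apply]
  obtain rfl | rfl := Bool.eq_or_eq_not j i
  exacts [h₂ _, by simpa using h₁ _]

end NAVariety

/-! ### No coefficients satisfy all the relations -/

namespace NAVariety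

section Rotation

variable {F : Type*} [Field F] {θ : Bool → Bool → Bool → Bool → F}

/-- The pure tensor of two vectors. -/
def tens (v w : Bool → F) : Bool × Bool → F := fun i => v i.1 * w i.2

/-- Up to sign and order of indices the system has matrix `R`, which is invertible because `R³ = 1`.
-/
theorem eq_zero_of_sum_rotation (h : rotation θ * rotation θ * rotation θ = 1) {M : Type*}
    [AddCommGroup M] [Module F M] (c : Bool → Bool → M)
    (hc : ∀ i k, ∑ q, ∑ l, θ q l i k • c q l = 0) (q l : Bool) : c q l = 0 := by
  rw [← Module.forall_dual_apply_eq_zero_iff F]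
  intro φ
  have h₁ : (rotation θ).mulVec (fun i => φ (c i.1 i.2)) = 0 := by
    ext i
    rw [rotation_mulVec, Pi.zero_apply, neg_eq_zero]
    have := congrArg φ (hc i.2 (!i.1))
    simpa [map_sum, mul_comm] using this
  have h₂ : (1 : Matrix (Bool × Bool) (Bool × Bool) F).mulVec (fun i => φ (c i.1 i.2)) = 0 := by
    rw [← h, ← Matrix.mulVec_mulVec, h₁, Matrix.mulVec_zero]
  rw [Matrix.one_mulVec] at h₂
  exact congrFun h₂ (q, l)

/-- The hypothesis on `v` gives `R(v ⊗ m) = -ρ(m) ⊗ v`. With `σ` the swap of coordinates, the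
relations determine `R` on `ρ(m) ⊗ σv` and on `ρ(m) ⊗ v`. Since `ρ` is bijective, these force `v` to
be proportional to `σv`, and then every vector of the plane to be proportional to `σv`. -/
theorem rotation_contradiction_of_eigenvector
    (h₁ : transposition F * rotation θ * transposition F = rotation θ * rotation θ)
    (h₂ : rotation θ * rotation θ * rotation θ = 1) (v : Bool → F) (hv : v ≠ 0)
    (W : Bool → Bool → F) (hW : ∀ m j k, ∑ p, v p * θ p m j k = W m k * v j) : False := by
  set R := rotation θ with hR
  let ρ : (Bool → F) →ₗ[F] (Bool → F) :=
    { toFun := fun m i => ∑ q, m q * W q (!i)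
      map_add' := fun x y => by ext; simp [add_mul]; ring
      map_smul' := fun c x => by ext; simp; ring }
  let σ : (Bool → F) → Bool → F := fun m i => m (!i)
  have hσσ : ∀ m, σ (σ m) = m := fun m => funext fun i => by simp [σ]
  have hT : ∀ x y, (transposition F).mulVec (tens x y) = tens x (σ y) := fun x y => by
    rw [transposition_mulVec]
    rfl
  have hneg : ∀ M : Matrix (Bool × Bool) (Bool × Bool) F, ∀ x, M.mulVec (-x) = -M.mulVec x :=
    fun M x => Matrix.mulVec_neg x M
  have g₁ : ∀ m, R.mulVec (tens v m) = -tens (ρ m) v := by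
    intro m
    ext i
    rw [rotation_mulVec]
    have w₁ := hW true i.2 (!i.1)
    have w₂ := hW false i.2 (!i.1)
    simp only [Fintype.sum_bool, tens, Pi.neg_apply, ρ, LinearMap.coe_mk, AddHom.coe_mk] at *
    linear_combination (-m true) * w₁ + (-m false) * w₂
  have h₃ : ∀ x, (transposition F).mulVec (R.mulVec ((transposition F).mulVec x)) =
      R.mulVec (R.mulVec x) := fun x => by simp only [Matrix.mulVec_mulVec, ← Matrix.mul_assoc, h₁]
  have h₄ : ∀ x, R.mulVec (R.mulVec (R.mulVec x)) = x := fun x => by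
    simp only [Matrix.mulVec_mulVec, ← Matrix.mul_assoc, h₂, Matrix.one_mulVec]
  have hTT : ∀ x, (transposition F).mulVec ((transposition F).mulVec x) = x := fun x => by
    simp [transposition_mulVec]
  have g₂ : ∀ m, R.mulVec (tens (ρ m) (σ v)) = -tens v (σ m) := by
    intro m
    have := h₃ (R.mulVec (tens v m))
    rw [h₄, g₁, hneg, hT, hneg, hneg] at this
    rw [← hT v m, ← this, hneg, hTT, neg_neg]
  have g₃ : ∀ m, R.mulVec (tens (ρ m) v) = tens (ρ (σ m)) (σ v) := by
    intro m
    have := h₃ (tens v m)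
    rw [g₁, hneg, hT, g₁, hneg, hT] at this
    exact (neg_injective this).symm
  obtain ⟨n, hn⟩ := Function.ne_iff.1 hv
  rw [Pi.zero_apply] at hn
  have hρ : ∀ m, ρ m = 0 → m = 0 := by
    intro m hm
    have h₅ : R.mulVec (tens v m) = 0 := by
      rw [g₁, hm]
      ext i
      simp [tens]
    have h₆ := h₄ (tens v m)
    rw [h₅, Matrix.mulVec_zero, Matrix.mulVec_zero] at h₆
    ext i
    exact (mul_eq_zero.1 (congrFun h₆ (n, i)).symm).resolve_left hn
  have hsurj : Function.Surjective ρ := LinearMap.injective_iff_surjective.1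
    ((injective_iff_map_eq_zero ρ).2 hρ)
  -- Choosing `ρ(m₀) = v` makes both formulas for `R` apply to `v ⊗ v`.
  obtain ⟨m₀, hm₀⟩ := hsurj v
  have e₁ : -tens (ρ v) v = tens (ρ (σ m₀)) (σ v) := by rw [← g₁, ← g₃, hm₀]
  obtain ⟨i, hi⟩ := Function.ne_iff.1 (mt (hρ v) hv)
  rw [Pi.zero_apply] at hi
  obtain ⟨c, hc⟩ : ∃ c : F, v = c • σ v := by
    refine ⟨-(ρ (σ m₀) i) / ρ v i, funext fun j => ?_⟩
    have := congrFun e₁ (i, j)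
    simp only [Pi.neg_apply, tens] at this
    rw [Pi.smul_apply, smul_eq_mul]
    field_simp
    linear_combination -this
  have hc0 : c ≠ 0 := by
    rintro rfl
    exact hv (by rw [hc, zero_smul])
  have e₂ : ∀ m, ∃ d : F, m = d • σ v := by
    intro m
    have h₅ : tens (ρ (σ m)) v = c • tens (ρ (σ m)) (σ v) := by
      ext j
      have := congrFun hc j.2
      simp only [tens, Pi.smul_apply, smul_eq_mul] at this ⊢
      rw [this]
      ring
    have h₆ := g₃ (σ m)
    rw [h₅, Matrix.mulVec_smul, g₂, hσσ] at h₆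
    refine ⟨-(ρ m n) / (c * v n), funext fun j => ?_⟩
    have := congrFun h₆ (n, j)
    simp only [Pi.smul_apply, Pi.neg_apply, tens, smul_eq_mul] at this
    rw [Pi.smul_apply, smul_eq_mul]
    field_simp
    linear_combination -this
  obtain ⟨d₁, hd₁⟩ := e₂ (Pi.single true 1)
  obtain ⟨d₂, hd₂⟩ := e₂ (Pi.single false 1)
  have k₁ : 1 = d₁ * σ v true := by simpa using congrFun hd₁ true
  have k₂ : 0 = d₁ * σ v false := by simpa using congrFun hd₁ false
  have k₃ : 1 = d₂ * σ v false := by simpa using congrFun hd₂ false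
  have : (1 : F) = 0 := by
    linear_combination k₃ + (d₂ * σ v false) * k₁ - d₂ * σ v true * k₂
  exact one_ne_zero this

/-- The cross relation expresses combinations of products of the matrices `X m k` through these
matrices, and inverting `R` solves it for single products. If the four matrices form a basis, there
is a nonzero multiplicative functional on all 2 by 2 matrices. If not, their span is proper and
closed under products, so it has a common eigenvector. -/
theorem rotation_contradiction [IsAlgClosed F]
    (h₁ : transposition F * rotation θ * transposition F = rotation θ * rotation θ)
    (h₂ : rotation θ * rotation θ * rotation θ = 1)
    (h₃ : ∀ p p' m i j k : Bool, ∑ l, θ p m i l * θ p' (!l) j (!k) =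
      ∑ r, ∑ q, ∑ l, θ p' (!p) r (!q) * θ r (!m) j (!l) * θ q l i k) : False := by
  let X : Bool → Bool → Matrix Bool Bool F := fun m k => Matrix.of fun j p => θ p (!m) j (!k)
  have hX : ∀ p m i k, ∑ l, θ p m i l • X l k = ∑ q, ∑ l, θ q l i k • (X m l * X p q) := by
    intro p m i k
    ext j p'
    have := h₃ p p' m i j k
    simp only [Fintype.sum_bool, Matrix.add_apply, Matrix.smul_apply, X, Matrix.of_apply,
      smul_eq_mul, Matrix.mul_apply] at this ⊢
    linear_combination this
  let Y : Bool × Bool → Matrix Bool Bool F := fun i => X i.1 i.2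
  by_cases hli : LinearIndependent F Y
  · let e := basisOfLinearIndependentOfCardEqFinrank hli (by simp [Module.finrank_matrix])
    have he : ∀ i j, e (i, j) = X i j := fun i j => by simp [e, Y]
    -- Replacing each `X i j` by the Kronecker delta makes both sides of `hX` equal to `θ p m i k`;
    -- hence `f` respects products.
    let f : Matrix Bool Bool F →ₗ[F] F := e.constr F fun i => if i.1 = i.2 then 1 else 0
    have hf : ∀ i j, f (X i j) = if i = j then 1 else 0 := fun i j => by
      rw [← he, Module.Basis.constr_basis]
    have hfm : ∀ m l p q, f (X m l * X p q) = f (X m l) * f (X p q) := by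
      intro m l p q
      have := eq_zero_of_sum_rotation h₂
        (fun q l => f (X m l * X p q) - f (X m l) * f (X p q)) (fun i k => ?_) q l
      · exact sub_eq_zero.1 this
      · have := congrArg f (hX p m i k)
        simp only [map_sum, map_smul, hf, smul_eq_mul] at this
        simp only [smul_eq_mul, hf, mul_sub, Finset.sum_sub_distrib]
        rw [← this]
        simp
    have hfm' : ∀ x y, f (x * y) = f x * f y := by
      have : (LinearMap.mul F _).compr₂ f = (LinearMap.mul F F).compl₁₂ f f := by
        refine e.ext fun i => e.ext fun j => ?_
        simpa [he] using hfm i.1 i.2 j.1 j.2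
      exact fun x y => LinearMap.congr_fun (LinearMap.congr_fun this x) y
    have h₀ := not_multiplicative f hfm'
    have := hf true true
    rw [h₀] at this
    simp at this
  · let D : Submodule F (Matrix Bool Bool F) := Submodule.span F (Set.range Y)
    have hXD : ∀ i j, X i j ∈ D := fun i j => Submodule.subset_span ⟨(i, j), rfl⟩
    have hD : D ≠ ⊤ := by
      intro hD
      exact hli (linearIndependent_of_top_le_span_of_card_eq_finrank hD.ge
        (by simp [Module.finrank_matrix]))
    have hXX : ∀ m l p q, X m l * X p q ∈ D := by
      intro m l p q
      have := eq_zero_of_sum_rotation h₂ (fun q l => D.mkQ (X m l * X p q)) (fun i k => ?_) q l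
      · simpa using this
      · have := congrArg D.mkQ (hX p m i k)
        simp only [map_sum, map_smul] at this
        rw [← this]
        refine Finset.sum_eq_zero fun l _ => ?_
        rw [(D.mkQ_apply _).trans ((Submodule.Quotient.mk_eq_zero D).2 (hXD l k)), smul_zero]
    have hDD : ∀ x ∈ D, ∀ y ∈ D, x * y ∈ D := by
      intro x hx y hy
      have : D * D ≤ D := by
        rw [Submodule.span_mul_span, Submodule.span_le]
        rintro _ ⟨_, ⟨i, rfl⟩, _, ⟨j, rfl⟩, rfl⟩
        exact hXX _ _ _ _
      exact this (Submodule.mul_mem_mul hx hy)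
    let τ := (Matrix.toLinAlgEquiv' : Matrix Bool Bool F ≃ₐ[F] _)
    obtain ⟨v, hv, hev⟩ := exists_common_eigenvector (F := F) (E := Bool → F) (by simp)
      (D.map τ.toLinearMap) (by
        rintro _ ⟨x, hx, rfl⟩ _ ⟨y, hy, rfl⟩
        exact ⟨x * y, hDD x hx y hy, map_mul τ x y⟩) (by
        intro htop
        apply hD
        rw [Submodule.eq_top_iff']
        intro x
        have : τ x ∈ D.map τ.toLinearMap := htop ▸ Submodule.mem_top
        obtain ⟨y, hy, hxy⟩ := this
        exact τ.injective hxy ▸ hy)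
    choose! c hc using hev
    refine rotation_contradiction_of_eigenvector h₁ h₂ v hv
      (fun m k => c (τ (X (!m) (!k)))) fun m j k => ?_
    have := congrFun (hc (τ (X (!m) (!k))) ⟨_, hXD _ _, rfl⟩) j
    have h₄ : τ (X (!m) (!k)) v j = ∑ p, X (!m) (!k) j p * v p := rfl
    rw [h₄] at this
    simpa [X, mul_comm] using this

end Rotation

end NAVariety

/-! ### Anticommutativity and the Leibniz rule -/

namespace NAVariety

variable {K : Type u} [Field K] {V : NAVariety K}

theorem HasCofree.not_independent [Infinite K] (hV : V.HasCofree) {A₀ : V.Obj} {a a' : A₀}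
    {f : Bool → A₀ →ₗ[K] K} (hf : ∀ l m, f l (op m a a') = if l = m then 1 else 0) : False := by
  obtain ⟨θ, h⟩ := hV.exists_symmetric_rewrite hf
  obtain ⟨h₁, h₂⟩ := hV.rotation_eq hf h
  -- The relations are polynomial in `θ`, so they persist over the algebraic closure, where an
  -- eigenvalue exists.
  let i := algebraMap K (AlgebraicClosure K)
  have hR : rotation (fun p q k l => i (θ p q k l)) = i.mapMatrix (rotation θ) := by
    ext
    simp [rotation]
  have hT : transposition (AlgebraicClosure K) = i.mapMatrix (transposition K) := by
    ext
    simp [transposition, apply_ite]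
  refine rotation_contradiction (θ := fun p q k l => i (θ p q k l)) ?_ ?_ fun p p' m j k l => ?_
  · rw [hR, hT, ← map_mul, ← map_mul, h₁, map_mul]
  · rw [hR, ← map_mul, ← map_mul, h₂, map_one]
  · have := congrArg i (hV.cross_relation hf h p p' m j k l)
    simpa only [map_sum, map_mul] using this

/-- A variety with cofree split extensions is commutative or anticommutative. -/
theorem HasCofree.comm_or_anticomm [Infinite K] (hV : V.HasCofree) :
    (∀ (A : V.Obj) (x y : A), x * y = y * x) ∨ V.IsAnticommutative := by
  by_contra! h
  obtain ⟨A, a, a', f, hf⟩ := exists_independent (V := V)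
    (fun h' => by obtain ⟨A, x, y, hxy⟩ := h.1; exact hxy (h' A x y)) h.2
  exact hV.not_independent hf

/-- The rewriting rule collapses to two coefficients `μ` and `ν`. Exchanging `x` and `y` gives `ν =
ημ`, and expanding `x(by)` with `x` as the acting element gives `0 = μ(η + μ)` and `1 = μ²`. -/
theorem HasCofree.mul_mul_of_skew [Infinite K] (hV : V.HasCofree) (hne : V.IsNonabelian) {η : K}
    (hη : ∀ (A : V.Obj) (x y : A), x * y = η • (y * x)) (A : V.Obj) (b x y : A) :
    b * (x * y) = -η • (b * x * y + x * (b * y)) := by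
  obtain ⟨A₀, a, a', haa⟩ := hne
  have ha' : a' ≠ 0 := by
    rintro rfl
    exact haa (mul_zero _)
  obtain ⟨f, hf⟩ := exists_dual_eq_one K haa
  obtain ⟨g, hg⟩ := exists_dual_eq_one K ha'
  have hηη : η * η = 1 := by
    have h := hη A₀ a a'
    rw [hη A₀ a' a, smul_smul] at h
    have := congrArg f h
    rw [map_smul, hf, smul_eq_mul, mul_one] at this
    exact this.symm
  have pair : ∀ φ ψ : Dual A₀ →ₗ[K] K, ∃ (G : V.Obj) (s : Dual A₀ →ₙₐ[K] G)
      (X Y : Dual A₀ →ₗ[K] G) (E : G →ₗ[K] K), (∀ b z, s b * X z = X (b * z)) ∧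
      (∀ b z, s b * Y z = Y (b * z)) ∧ ∀ z₁ z₂, E (X z₁ * Y z₂) = φ z₁ * ψ z₂ := by
    intro φ ψ
    obtain ⟨G, s, X, Y, E, hX, hY, hE⟩ := hV.exists_pairing A₀.dual A₀ a a' φ ψ
    refine ⟨G, s, X, Y, f ∘ₗ E, hX false, hY false, fun z₁ z₂ => ?_⟩
    refine (congrArg f (hE false z₁ z₂)).trans ?_
    rw [map_smul, op_false, hf, smul_eq_mul, mul_one]
  obtain ⟨G₁, s₁, X₁, Y₁, E₁, hX₁, hY₁, hE₁⟩ := pair (f ∘ₗ Dual.imₗ) (g ∘ₗ Dual.reₗ)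
  obtain ⟨G₂, s₂, X₂, Y₂, E₂, hX₂, hY₂, hE₂⟩ := pair (g ∘ₗ Dual.reₗ) (f ∘ₗ Dual.imₗ)
  let b₀ : Dual A₀ := ⟨0, a⟩
  let x₀ : Dual A₀ := ⟨a', 0⟩
  have hbx : b₀ * x₀ = ⟨0, a * a'⟩ := by ext <;> simp [b₀, x₀]
  obtain ⟨μ, ν, h⟩ : ∃ μ ν : K, ∀ (A : V.Obj) (b x y : A),
      b * (x * y) = μ • (b * x * y) + ν • (b * y * x) := by
    obtain ⟨θ, β, h⟩ := hV.exists_rewrite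
    let e : Bool → K := fun k => cond k η 1
    have he : ∀ (A : V.Obj) (k : Bool) (x y : A), op k x y = e k • (x * y) := by
      intro A k x y
      cases k
      · simp [e]
      · exact hη A y x
    refine ⟨∑ k, ∑ l, θ false false k l * (e l * e k), ∑ k, ∑ l, β false false k l * (e l * e k),
      fun A b x y => ?_⟩
    refine (h A false false b x y).trans ?_
    simp only [he, smul_mul_assoc, smul_smul, Finset.sum_add_distrib, Finset.sum_smul]
  have hν : ν = η * μ := by
    have h₁ := h G₁ (s₁ b₀) (Y₁ x₀) (X₁ x₀)
    rw [hη G₁ (Y₁ x₀), mul_smul_comm, h, hX₁, hY₁, hη G₁ (Y₁ _) (X₁ _)] at h₁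
    have h₂ := congrArg E₁ h₁
    simp only [map_add, map_smul, hE₁, hbx] at h₂
    simpa [hf, hg, x₀, eq_comm] using h₂
  have hD : ∀ (A : V.Obj) (b x y : A), b * (x * y) = μ • (b * x * y + x * (b * y)) := by
    intro A b x y
    rw [h, hν, hη A x (b * y), smul_add, smul_smul, mul_comm]
  have hexp : ∀ {G : V.Obj} {s : Dual A₀ →ₙₐ[K] G} {X Y : Dual A₀ →ₗ[K] G}
      (_ : ∀ b z, s b * X z = X (b * z)) (_ : ∀ b z, s b * Y z = Y (b * z)),
      X x₀ * Y (b₀ * x₀) = μ • (η • (X (b₀ * x₀) * Y x₀) +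
        μ • (X (b₀ * x₀) * Y x₀ + X x₀ * Y (b₀ * x₀))) := by
    intro G s X Y hX hY
    have e : X x₀ * (s b₀ * Y x₀) = μ • (η • (s b₀ * X x₀ * Y x₀) +
        μ • (s b₀ * X x₀ * Y x₀ + X x₀ * (s b₀ * Y x₀))) := by
      rw [← hD, ← smul_mul_assoc, ← hη, ← hD]
    rwa [hX, hY] at e
  have k₁ := congrArg E₁ (hexp hX₁ hY₁)
  have k₂ := congrArg E₂ (hexp hX₂ hY₂)
  simp only [map_add, map_smul, hE₁, hE₂, hbx] at k₁ k₂
  have k₁' : 0 = μ * (η + μ) := by simpa [hf, hg, x₀] using k₁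
  have k₂' : 1 = μ * μ := by simpa [hf, hg, x₀] using k₂
  have hμ : μ = -η := by
    linear_combination (-μ) * k₁' + (μ + η) * k₂'
  rw [hD, hμ]

/-- A nonabelian commutative variety with cofree split extensions lives in characteristic two. -/
theorem HasCofree.two_eq_zero [Infinite K] (hV : V.HasCofree) (hne : V.IsNonabelian)
    (hc : ∀ (A : V.Obj) (x y : A), x * y = y * x) : (2 : K) = 0 := by
  have hD := hV.mul_mul_of_skew hne (η := 1) (fun A x y => by rw [one_smul, hc])
  simp only [neg_smul, one_smul] at hD
  obtain ⟨A₀, a, a', haa⟩ := hne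
  obtain ⟨f, hf⟩ := exists_dual_eq_one K haa
  obtain ⟨G, s, X, Y, E, hX, hY, hE⟩ := hV.exists_pairing A₀.dual A₀ a a' (f ∘ₗ Dual.imₗ)
    (f ∘ₗ Dual.imₗ)
  let b₀ : Dual A₀ := ⟨0, a⟩
  let x₀ : Dual A₀ := ⟨a', 0⟩
  have hX : ∀ b z, s b * X z = X (b * z) := hX false
  have hY : ∀ b z, s b * Y z = Y (b * z) := hY false
  have hE : ∀ z₁ z₂, f (E (X z₁ * Y z₂)) = f z₁.im * f z₂.im := fun z₁ z₂ => by
    refine (congrArg f (hE false z₁ z₂)).trans ?_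
    rw [map_smul, op_false, hf]
    simp
  have hbx : b₀ * x₀ = ⟨0, a * a'⟩ := by ext <;> simp [b₀, x₀]
  have hbb : b₀ * b₀ = 0 := by ext <;> simp [b₀]
  have e : ∀ z₁ z₂, s b₀ * (X z₁ * Y z₂) = -(X (b₀ * z₁) * Y z₂ + X z₁ * Y (b₀ * z₂)) := by
    intro z₁ z₂
    rw [hD, hX, hY]
  -- Since `b₀² = 0`, this says that twice the double action of `b₀` on `XY` is zero. That double
  -- action is itself `2(b₀X)(b₀Y)`, as `b₀(b₀x₀) = 0`; hence `4 = 0`.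
  have h₁ := hD G (X x₀ * Y x₀) (s b₀) (s b₀)
  rw [← map_mul, hbb, map_zero, mul_zero, hc G (X x₀ * Y x₀) (s b₀), hc G _ (s b₀), e, mul_neg,
    mul_add, e, e] at h₁
  have h₂ := congrArg (fun z => f (E z)) h₁
  simp only [map_add, map_neg, hE, map_zero, hbx] at h₂
  have h₃ : (2 : K) * 2 = 0 := by
    simp [x₀, b₀, hf] at h₂
    linear_combination h₂
  exact mul_self_eq_zero.1 h₃

theorem HasCofree.isAnticommutative [Infinite K] (hV : V.HasCofree) (hne : V.IsNonabelian) :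
    V.IsAnticommutative := by
  refine hV.comm_or_anticomm.elim (fun hc A x y => ?_) id
  have h := hV.two_eq_zero hne hc
  have h' : (2 : K) • (y * x) = 0 := by rw [h, zero_smul]
  rw [two_smul] at h'
  rw [hc A x y]
  exact eq_neg_of_add_eq_zero_left h'

theorem HasCofree.leibniz [Infinite K] (hV : V.HasCofree) (hne : V.IsNonabelian) (A : V.Obj)
    (b x y : A) : b * (x * y) = b * x * y + x * (b * y) := by
  have := hV.mul_mul_of_skew hne (η := -1)
    (fun A x y => by rw [neg_smul, one_smul, ← hV.isAnticommutative hne]) A b x y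
  simpa using this

end NAVariety

/-! ### The Poincaré–Birkhoff–Witt representation -/

namespace NAVariety

section PBW

open Finsupp Module

variable {K L I : Type*} [Field K] [LieRing L] [LieAlgebra K L] [LinearOrder I]

theorem exists_mem_forall_le {M : Multiset I} (hM : M ≠ 0) : ∃ j ∈ M, ∀ k ∈ M, j ≤ k := by
  classical
  obtain ⟨a, ha⟩ := Multiset.exists_mem_of_ne_zero hM
  obtain ⟨j, hj, h⟩ := M.toFinset.exists_min_image id ⟨a, Multiset.mem_toFinset.2 ha⟩
  exact ⟨j, Multiset.mem_toFinset.1 hj, fun k hk => h k (Multiset.mem_toFinset.2 hk)⟩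

open Classical in
/-- The action of a basis vector of a Lie algebra on a monomial of its symmetric algebra, in the
proof of the Poincaré–Birkhoff–Witt theorem. -/
noncomputable def pbwAct (b : Basis I K L) (i : I) (M : Multiset I) : Multiset I →₀ K :=
  if h : ∀ k ∈ M, i ≤ k then single (i ::ₘ M) 1 else
    have hM : M ≠ 0 := by
      rintro rfl
      simp at h
    let j := (exists_mem_forall_le hM).choose
    have hj : (M.erase j).card < M.card :=
      Multiset.card_erase_lt_of_mem (exists_mem_forall_le hM).choose_spec.1
    single (i ::ₘ M) 1 +
      -- The recursion imposes `bᵢ(bⱼN) = bⱼ(bᵢN) + [bᵢ, bⱼ]N` for `j` minimal. The degree test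
      -- serves only termination: `pbwAct_sub_mem` shows that it always succeeds.
      ((pbwAct b i (M.erase j) - single (i ::ₘ M.erase j) 1).sum fun P c =>
        if _ : P.card < M.card then c • pbwAct b j P else 0) +
      (b.repr ⁅b i, b j⁆).sum fun l c => c • pbwAct b l (M.erase j)
termination_by M.card

theorem pbwAct_of_le (b : Basis I K L) {i : I} {M : Multiset I} (h : ∀ k ∈ M, i ≤ k) :
    pbwAct b i M = single (i ::ₘ M) 1 := by
  rw [pbwAct, dif_pos h]

theorem exists_min_unique {M : Multiset I} {j j' : I} (hj : j ∈ M) (h : ∀ k ∈ M, j ≤ k)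
    (hj' : j' ∈ M) (h' : ∀ k ∈ M, j' ≤ k) : j = j' := le_antisymm (h _ hj') (h' _ hj)

open Classical in
theorem pbwAct_cons (b : Basis I K L) {i j : I} {N : Multiset I} (hN : ∀ k ∈ N, j ≤ k)
    (hij : j < i) : pbwAct b i (j ::ₘ N) = single (i ::ₘ j ::ₘ N) 1 +
      ((pbwAct b i N - single (i ::ₘ N) 1).sum fun P c =>
        if P.card ≤ N.card then c • pbwAct b j P else 0) +
      (b.repr ⁅b i, b j⁆).sum fun l c => c • pbwAct b l N := by
  have h : ¬ ∀ k ∈ j ::ₘ N, i ≤ k := fun h => (h j (Multiset.mem_cons_self j N)).not_gt hij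
  have hM : j ::ₘ N ≠ 0 := Multiset.cons_ne_zero
  have hj : (exists_mem_forall_le hM).choose = j :=
    exists_min_unique (exists_mem_forall_le hM).choose_spec.1
      (exists_mem_forall_le hM).choose_spec.2 (Multiset.mem_cons_self j N) (by simpa using hN)
  rw [pbwAct, dif_neg h]
  simp only [hj, Multiset.erase_cons_head, Multiset.card_cons, Nat.lt_succ_iff, dite_eq_ite]

/-- The linear extension of `pbwAct`. -/
noncomputable def pbwHom (b : Basis I K L) : L →ₗ[K] (Multiset I →₀ K) →ₗ[K] (Multiset I →₀ K) :=
  b.constr K fun i => Finsupp.linearCombination K (pbwAct b i)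

theorem pbwHom_basis_single (b : Basis I K L) (i : I) (M : Multiset I) :
    pbwHom b (b i) (single M 1) = pbwAct b i M := by
  simp [pbwHom]

theorem pbwHom_single (b : Basis I K L) (x : L) (M : Multiset I) :
    pbwHom b x (single M 1) = (b.repr x).sum fun l c => c • pbwAct b l M := by
  conv_lhs => rw [← b.linearCombination_repr x]
  rw [Finsupp.linearCombination_apply, Finsupp.sum, map_sum, LinearMap.sum_apply]
  refine Finset.sum_congr rfl fun i _ => ?_
  rw [map_smul, LinearMap.smul_apply, pbwHom_basis_single]

theorem pbwHom_basis (b : Basis I K L) (i : I) (w : Multiset I →₀ K) :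
    pbwHom b (b i) w = w.sum fun P c => c • pbwAct b i P := by
  simp [pbwHom, Finsupp.linearCombination_apply]

end PBW

section Degree

variable {K I : Type*} [Field K]

open Finsupp

/-- Combinations of monomials of bounded degree. -/
def pbwDegreeLE (K I : Type*) [Field K] (n : ℕ) : Submodule K (Multiset I →₀ K) :=
  Finsupp.supported K K {P : Multiset I | P.card ≤ n}

theorem pbwDegreeLE_mono {m n : ℕ} (h : m ≤ n) : pbwDegreeLE K I m ≤ pbwDegreeLE K I n :=
  Finsupp.supported_mono fun _ hP => le_trans hP h

theorem single_mem_pbwDegreeLE (M : Multiset I) {n : ℕ} (h : M.card ≤ n) :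
    single M 1 ∈ pbwDegreeLE K I n := Finsupp.single_mem_supported K _ h

end Degree

section PBW

open Finsupp Module

variable {K L I : Type*} [Field K] [LieRing L] [LieAlgebra K L] [LinearOrder I]

theorem pbwAct_sub_mem (b : Basis I K L) (i : I) (M : Multiset I) :
    pbwAct b i M - single (i ::ₘ M) 1 ∈ pbwDegreeLE K I M.card := by
  classical
  induction hn : M.card using Nat.strong_induction_on generalizing i M with
  | _ n ih =>
    by_cases h : ∀ k ∈ M, i ≤ k
    · rw [pbwAct_of_le b h, sub_self]
      exact Submodule.zero_mem _
    · have hM : M ≠ 0 := by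
        rintro rfl
        simp at h
      obtain ⟨j, hj, hjM⟩ := exists_mem_forall_le hM
      obtain ⟨N, rfl⟩ := Multiset.exists_cons_of_mem hj
      have hji : j < i := by
        push Not at h
        obtain ⟨k, hk, hki⟩ := h
        exact (hjM k hk).trans_lt hki
      have hmem : ∀ l (P : Multiset I), P.card ≤ N.card → pbwAct b l P ∈ pbwDegreeLE K I n := by
        intro l P hP
        rw [Multiset.card_cons] at hn
        rw [← sub_add_cancel (pbwAct b l P) (single (l ::ₘ P) 1)]
        refine Submodule.add_mem _ (pbwDegreeLE_mono (by omega) (ih P.card (by omega) l P rfl))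
          (single_mem_pbwDegreeLE _ ?_)
        rw [Multiset.card_cons]
        omega
      rw [pbwAct_cons b (fun k hk => hjM k (Multiset.mem_cons_of_mem hk)) hji, add_assoc,
        add_sub_cancel_left]
      refine Submodule.add_mem _ (Submodule.sum_mem _ fun P _ => ?_)
        (Submodule.sum_mem _ fun l _ => Submodule.smul_mem _ _ (hmem l N le_rfl))
      dsimp only
      split_ifs with hP
      · exact Submodule.smul_mem _ _ (hmem j P hP)
      · exact Submodule.zero_mem _

theorem pbwHom_cons (b : Basis I K L) {i j : I} {N : Multiset I} (hN : ∀ k ∈ N, j ≤ k)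
    (hij : j < i) : pbwHom b (b i) (single (j ::ₘ N) 1) =
      pbwHom b (b j) (pbwHom b (b i) (single N 1)) + pbwHom b ⁅b i, b j⁆ (single N 1) := by
  classical
  rw [pbwHom_basis_single, pbwAct_cons b hN hij, pbwHom_single b ⁅b i, b j⁆, pbwHom_basis_single]
  congr 1
  have h₁ : pbwAct b i N = single (i ::ₘ N) 1 + (pbwAct b i N - single (i ::ₘ N) 1) := by abel
  conv_rhs => rw [h₁, map_add, pbwHom_basis_single, pbwHom_basis]
  rw [pbwAct_of_le b (M := i ::ₘ N) (by
    intro k hk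
    obtain rfl | hk := Multiset.mem_cons.1 hk
    exacts [hij.le, hN k hk]), Multiset.cons_swap]
  congr 1
  refine Finset.sum_congr rfl fun P hP => ?_
  exact if_pos (pbwAct_sub_mem b i N hP)

theorem pbwHom_comm_of_le (b : Basis I K L) {i j : I} {N : Multiset I} (hN : ∀ k ∈ N, j ≤ k) :
    pbwHom b (b i) (pbwHom b (b j) (single N 1)) =
      pbwHom b (b j) (pbwHom b (b i) (single N 1)) + pbwHom b ⁅b i, b j⁆ (single N 1) := by
  obtain h | rfl | h := lt_trichotomy j i
  · rw [pbwHom_basis_single b j, pbwAct_of_le b hN, pbwHom_cons b hN h]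
  · simp
  · have hN' : ∀ k ∈ N, i ≤ k := fun k hk => h.le.trans (hN k hk)
    rw [pbwHom_basis_single b i N, pbwAct_of_le b hN', pbwHom_cons b hN' h, ← lie_skew (b i),
      map_neg, LinearMap.neg_apply]
    abel

theorem pbwHom_comm_of_basis (b : Basis I K L) (w : Multiset I →₀ K)
    (h : ∀ i j, pbwHom b (b i) (pbwHom b (b j) w) =
      pbwHom b (b j) (pbwHom b (b i) w) + pbwHom b ⁅b i, b j⁆ w) (x y : L) :
    pbwHom b x (pbwHom b y w) = pbwHom b y (pbwHom b x w) + pbwHom b ⁅x, y⁆ w := by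
  induction b.mem_span x using Submodule.span_induction with
  | zero => simp
  | add x x' _ _ hx hx' => simp only [map_add, LinearMap.add_apply, hx, hx', add_lie]; abel
  | smul c x _ hx => simp only [map_smul, LinearMap.smul_apply, hx, smul_lie, smul_add]
  | mem x hx =>
    obtain ⟨i, rfl⟩ := hx
    induction b.mem_span y using Submodule.span_induction with
    | zero => simp
    | add x x' _ _ hx hx' => simp only [map_add, LinearMap.add_apply, hx, hx', lie_add]; abel
    | smul c x _ hx => simp only [map_smul, LinearMap.smul_apply, hx, lie_smul, smul_add]
    | mem y hy =>
      obtain ⟨j, rfl⟩ := hy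
      exact h i j

/-- Induction on the degree. If `i` or `j` is at most every index of `N`, the relation is built into
the definition. Otherwise the minimal index `k` of `N` is split off, and the Jacobi identity for
`bᵢ`, `bⱼ`, `bₖ` reduces the claim to lower degree. -/
theorem pbwHom_comm (b : Basis I K L) (x y : L) (N : Multiset I) :
    pbwHom b x (pbwHom b y (single N 1)) =
      pbwHom b y (pbwHom b x (single N 1)) + pbwHom b ⁅x, y⁆ (single N 1) := by
  induction hn : N.card using Nat.strong_induction_on generalizing N x y with
  | _ n ih =>
    refine pbwHom_comm_of_basis b _ (fun i j => ?_) x y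
    by_cases hN : N = 0
    · exact pbwHom_comm_of_le b (by simp [hN])
    obtain ⟨k, hk, hkN⟩ := exists_mem_forall_le hN
    obtain ⟨P, rfl⟩ := Multiset.exists_cons_of_mem hk
    have hP : ∀ l ∈ P, k ≤ l := fun l hl => hkN l (Multiset.mem_cons_of_mem hl)
    by_cases hjk : j ≤ k
    · exact pbwHom_comm_of_le b fun l hl => hjk.trans (hkN l hl)
    by_cases hik : i ≤ k
    · have := pbwHom_comm_of_le b (i := j) (N := k ::ₘ P) fun l hl => hik.trans (hkN l hl)
      rw [this, ← lie_skew (b i), map_neg, LinearMap.neg_apply]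
      abel
    push Not at hjk hik
    rw [Multiset.card_cons] at hn
    have ih' : ∀ x y, pbwHom b x (pbwHom b y (single P 1)) =
        pbwHom b y (pbwHom b x (single P 1)) + pbwHom b ⁅x, y⁆ (single P 1) :=
      fun x y => ih P.card (by omega) x y P rfl
    have ihw : ∀ w ∈ pbwDegreeLE K I P.card, ∀ x y, pbwHom b x (pbwHom b y w) =
        pbwHom b y (pbwHom b x w) + pbwHom b ⁅x, y⁆ w := by
      intro w hw x y
      rw [pbwDegreeLE, Finsupp.supported_eq_span_single] at hw
      induction hw using Submodule.span_induction with
      | mem w hw =>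
        obtain ⟨Q, hQ, rfl⟩ := hw
        exact ih Q.card (by have : Q.card ≤ P.card := hQ; omega) x y Q rfl
      | zero => simp
      | add w w' _ _ h h' => simp only [map_add, h, h']; abel
      | smul c w _ h => simp only [map_smul, h, smul_add]
    -- The leading monomial of `bⱼP` has minimal index `k`, so the defining relation applies to it;
    -- the remainder has degree at most that of `P` and falls under the induction hypothesis.
    have e₁ : ∀ i j, k < i → k < j → pbwHom b (b i) (pbwHom b (b k) (pbwHom b (b j) (single P 1))) =
        pbwHom b (b k) (pbwHom b (b i) (pbwHom b (b j) (single P 1))) +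
          pbwHom b ⁅b i, b k⁆ (pbwHom b (b j) (single P 1)) := by
      intro i j hi hj
      have h₁ : pbwHom b (b j) (single P 1) =
          single (j ::ₘ P) 1 + (pbwAct b j P - single (j ::ₘ P) 1) := by
        rw [pbwHom_basis_single]
        abel
      have h₂ := ihw _ (pbwAct_sub_mem b j P) (b i) (b k)
      have h₃ := pbwHom_comm_of_le b (i := i) (j := k) (N := j ::ₘ P) (by
        intro l hl
        obtain rfl | hl := Multiset.mem_cons.1 hl
        exacts [hj.le, hP l hl])
      generalize pbwAct b j P - single (j ::ₘ P) 1 = w at h₁ h₂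
      simp only [h₁, map_add, h₂, h₃]
      abel
    have e₂ : ∀ x, pbwHom b x (single (k ::ₘ P) 1) =
        pbwHom b (b k) (pbwHom b x (single P 1)) + pbwHom b ⁅x, b k⁆ (single P 1) := by
      intro x
      rw [← ih', pbwHom_basis_single b k, pbwAct_of_le b hP]
    rw [e₂, e₂, e₂, map_add, map_add, e₁ i j hik hjk, e₁ j i hjk hik, ih' (b i) (b j), map_add,
      ih' (b i) ⁅b j, b k⁆, ih' (b j) ⁅b i, b k⁆, lie_lie (b i) (b j) (b k), map_sub,
      LinearMap.sub_apply]
    abel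

/-- The Ado-type consequence of the Poincaré–Birkhoff–Witt theorem: each Lie algebra over a field
has a faithful representation. -/
theorem exists_faithful_representation (K L : Type u) [Field K] [LieRing L] [LieAlgebra K L] :
    ∃ (S : Type u) (_ : AddCommGroup S) (_ : Module K S) (ρ : L →ₗ[K] Module.End K S),
      Function.Injective ρ ∧ ∀ x y, ρ ⁅x, y⁆ = ρ x * ρ y - ρ y * ρ x := by
  classical
  let b := Basis.ofVectorSpace K L
  let : LinearOrder (Basis.ofVectorSpaceIndex K L) := linearOrderOfSTO WellOrderingRel
  refine ⟨Multiset (Basis.ofVectorSpaceIndex K L) →₀ K, inferInstance, inferInstance, pbwHom b,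
    (injective_iff_map_eq_zero _).2 fun x hx => ?_, fun x y => ?_⟩
  -- On the empty monomial `bᵢ` gives the monomial `{i}`, so the coordinates of `x` can be read off.
  · have h := LinearMap.congr_fun hx (single 0 1)
    rw [pbwHom_single, LinearMap.zero_apply] at h
    apply b.repr.injective
    rw [map_zero]
    ext i
    have h₁ := DFunLike.congr_fun h {i}
    rw [Finsupp.sum_apply] at h₁
    simpa [pbwAct_of_le, Finsupp.single_apply, Finsupp.sum] using h₁
  · refine Finsupp.lhom_ext' fun N => LinearMap.ext_ring ?_
    have := pbwHom_comm b x y N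
    simp [this]

end PBW

end NAVariety

/-! ### Left multiplications satisfy no associative identity -/

namespace NAVariety

variable {K : Type u} [Field K]

section Words

/-- The free associative algebra on countably many generators. -/
abbrev Words (K : Type u) [Field K] := MonoidAlgebra K (FreeMonoid ℕ)

/-- The action of associative polynomials by iterated left multiplications. -/
noncomputable def wordAct {M : Type*} [AddCommGroup M] [Module K M] (F : ℕ → Module.End K M) :
    Words K →ₐ[K] Module.End K M :=
  MonoidAlgebra.lift K _ _ (FreeMonoid.lift F)

variable {M : Type*} [AddCommGroup M] [Module K M] (F : ℕ → Module.End K M)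

theorem wordAct_one (c : K) : wordAct F (.single 1 c) = c • 1 := by
  rw [wordAct, MonoidAlgebra.lift_single, map_one]

theorem wordAct_mul_of (w : FreeMonoid ℕ) (j : ℕ) (c : K) (z : M) :
    wordAct F (.single (w * .of j) c) z = wordAct F (.single w c) (F j z) := by
  simp [wordAct]

theorem of_concat_induction {P : FreeMonoid ℕ → Prop} (one : P 1)
    (mul_of : ∀ w i, P w → P (w * .of i)) (w : FreeMonoid ℕ) : P w :=
  List.reverseRecOn (motive := P) w one mul_of

theorem map_wordAct {N : Type*} [AddCommGroup N] [Module K N] {F' : ℕ → Module.End K N}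
    (f : M →ₗ[K] N) (hf : ∀ j z, f (F j z) = F' j (f z)) (u : Words K) (z : M) :
    f (wordAct F u z) = wordAct F' u (f z) := by
  induction u using MonoidAlgebra.induction_linear with
  | zero => simp
  | add u v hu hv => simp only [map_add, LinearMap.add_apply, hu, hv]
  | single w c =>
    induction w using of_concat_induction generalizing z with
    | one => simp [wordAct_one]
    | mul_of w i ih => rw [wordAct_mul_of, wordAct_mul_of, ih, hf]

theorem mul_of_injective (i : ℕ) : Function.Injective fun w : FreeMonoid ℕ => w * .of i :=
  mul_left_injective _

/-- The `i`-th right derivative: the sum of the words that end in `i`, with the last letter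
removed. -/
noncomputable def rightDeriv (i : ℕ) : Words K →ₗ[K] Words K where
  toFun u := .ofCoeff (u.coeff.comapDomain (fun w => w * .of i) (mul_of_injective i).injOn)
  map_add' u v := by ext; simp
  map_smul' c u := by ext; simp

theorem coeff_rightDeriv (i : ℕ) (u : Words K) (w : FreeMonoid ℕ) :
    (rightDeriv i u).coeff w = u.coeff (w * .of i) := by
  simp [rightDeriv]

theorem rightDeriv_one (i : ℕ) (c : K) : rightDeriv i (.single 1 c) = 0 := by
  classical
  ext w
  rw [coeff_rightDeriv, MonoidAlgebra.coeff_single, Finsupp.single_apply, if_neg]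
  · rfl
  · intro h
    simpa using congrArg FreeMonoid.length h

theorem rightDeriv_mul_of (i j : ℕ) (w : FreeMonoid ℕ) (c : K) :
    rightDeriv i (.single (w * .of j) c) = if j = i then .single w c else 0 := by
  classical
  have hinj : ∀ w', w * .of j = w' * .of i ↔ w = w' ∧ j = i := by
    intro w'
    refine ⟨fun h => ?_, fun h => by rw [h.1, h.2]⟩
    have := List.append_inj' (congrArg FreeMonoid.toList h) rfl
    exact ⟨FreeMonoid.toList.injective this.1, by simpa using this.2⟩
  ext w'
  rw [coeff_rightDeriv, MonoidAlgebra.coeff_single, Finsupp.single_apply]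
  split_ifs with h h' h'
  · rw [MonoidAlgebra.coeff_single, Finsupp.single_apply, if_pos ((hinj _).1 h).1]
  · exact absurd ((hinj _).1 h).2 h'
  · rw [MonoidAlgebra.coeff_single, Finsupp.single_apply, if_neg fun e => h ((hinj _).2 ⟨e, h'⟩)]
  · rfl

/-- A linear identity between two actions of words follows from the behaviour on the last
letter. -/
theorem words_induction {P : Words K → Prop} (zero : P 0) (add : ∀ u v, P u → P v → P (u + v))
    (one : ∀ c, P (.single 1 c)) (mul_of : ∀ w i c, P (.single (w * .of i) c)) (u : Words K) :
    P u := by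
  induction u using MonoidAlgebra.induction_linear with
  | zero => exact zero
  | add u v hu hv => exact add u v hu hv
  | single w c =>
    exact of_concat_induction (P := fun w => P (.single w c)) (one c)
      (fun w i _ => mul_of w i c) w

end Words

variable {V : NAVariety K}

/-- Polynomials that annihilate all of `V` have zero constant term, by substituting zero, and are
closed under right derivatives. Stripping letters from the right therefore shows that every
coefficient is zero. -/
theorem HasCofree.coeff_eq_zero [Infinite K] (hV : V.HasCofree) (hne : V.IsNonabelian)
    (u : Words K) (hu : ∀ (A : V.Obj) (v : ℕ → A), wordAct (fun i => LinearMap.mul K A (v i)) u = 0) :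
    u = 0 := by
  obtain ⟨A₀, a, a', haa⟩ := hne
  have ha' : a' ≠ 0 := by
    rintro rfl
    exact haa (mul_zero _)
  obtain ⟨g, hg⟩ := exists_dual_eq_one K ha'
  obtain ⟨f, hf⟩ := exists_dual_eq_one K haa
  have key : ∀ u : Words K, (∀ (A : V.Obj) (v : ℕ → A),
      wordAct (fun i => LinearMap.mul K A (v i)) u = 0) → u.coeff 1 = 0 ∧ ∀ i, ∀ (A : V.Obj)
        (v : ℕ → A), wordAct (fun i => LinearMap.mul K A (v i)) (rightDeriv i u) = 0 := by
    intro u hu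
    constructor
    · have h₁ : ∀ u : Words K, wordAct (fun _ => LinearMap.mul K A₀ 0) u a' = u.coeff 1 • a' := by
        intro u
        induction u using words_induction with
        | zero => simp
        | add u v hu hv =>
          simp only [map_add, LinearMap.add_apply, hu, hv, MonoidAlgebra.coeff_add,
            Finsupp.add_apply, add_smul]
        | one c => simp [wordAct_one]
        | mul_of w i c =>
          rw [wordAct_mul_of, map_zero, LinearMap.zero_apply, map_zero, MonoidAlgebra.coeff_single,
            Finsupp.single_eq_of_ne, zero_smul]
          intro h
          simpa using congrArg FreeMonoid.length h
      have h₂ := h₁ u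
      rw [hu A₀ (fun _ => 0), LinearMap.zero_apply] at h₂
      exact (smul_eq_zero.1 h₂.symm).resolve_right ha'
    · refine fun i A v => LinearMap.ext fun y =>
        (Module.forall_dual_apply_eq_zero_iff K _).1 fun ψ => ?_
      obtain ⟨G, s, Y, X, E, hY, hX, hE⟩ := hV.exists_pairing (A.prod A₀) A₀ a a'
        (ψ ∘ₗ LinearMap.fst K A A₀) (g ∘ₗ LinearMap.snd K A A₀)
      let b : ℕ → A × A₀ := fun j => (v j, 0)
      let x₀ : A × A₀ := (0, a')
      let y₀ : A × A₀ := (y, 0)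
      -- All `b j` kill `X x₀`, so a word in `w` survives on `X x₀` only if its last letter is `i`,
      -- giving `(Y y₀)(X x₀)ε`. By the Leibniz rule the other letters then act on the factor `Y y₀`
      -- alone.
      let w : ℕ → Dual G := fun j => ⟨s (b j), if j = i then Y y₀ else 0⟩
      let Y' : A →ₗ[K] G := (LinearMap.mul K G).flip (X x₀) ∘ₗ Y ∘ₗ LinearMap.inl K A A₀
      have hX₀ : ∀ j, s (b j) * X x₀ = 0 := by
        intro j
        have h : b j * x₀ = 0 := by simp [b, x₀]
        exact (hX false (b j) x₀).trans (by rw [op_false, h, map_zero])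
      have c₁ : ∀ u z, Y' (wordAct (fun j => LinearMap.mul K A (v j)) u z) =
          wordAct (fun j => LinearMap.mul K G (s (b j))) u (Y' z) := by
        refine map_wordAct _ Y' fun j z => ?_
        have h : s (b j) * Y (z, 0) = Y (v j * z, 0) := by
          refine (hY false (b j) (z, 0)).trans ?_
          congr 1
          simp [b]
        show Y (v j * z, 0) * X x₀ = s (b j) * (Y (z, 0) * X x₀)
        rw [hV.leibniz ⟨A₀, a, a', haa⟩, hX₀, mul_zero, add_zero, h]
      let inr : G →ₗ[K] Dual G :=
        { toFun := fun z => ⟨0, z⟩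
          map_add' := fun _ _ => by ext <;> simp
          map_smul' := fun _ _ => by ext <;> simp }
      have c₂ : ∀ u z, inr (wordAct (fun j => LinearMap.mul K G (s (b j))) u z) =
          wordAct (fun j => LinearMap.mul K (Dual G) (w j)) u (inr z) := by
        refine map_wordAct _ inr fun j z => ?_
        ext <;> simp [inr, w]
      have c₃ : ∀ u, (wordAct (fun j => LinearMap.mul K (Dual G) (w j)) u ⟨X x₀, 0⟩).im =
          wordAct (fun j => LinearMap.mul K G (s (b j))) (rightDeriv i u) (Y' y) := by
        intro u
        induction u using words_induction with
        | zero => simp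
        | add u v hu hv => simp only [map_add, LinearMap.add_apply, Dual.im_add, hu, hv]
        | one c => simp [wordAct_one, rightDeriv_one]
        | mul_of m j c =>
          rw [wordAct_mul_of, rightDeriv_mul_of]
          have h : LinearMap.mul K (Dual G) (w j) ⟨X x₀, 0⟩ = inr (if j = i then Y' y else 0) := by
            ext
            · exact hX₀ j
            · show s (b j) * 0 + (if j = i then Y y₀ else 0) * X x₀ = if j = i then Y' y else 0
              split_ifs
              · rw [mul_zero, zero_add]
                rfl
              · simp
          rw [h, ← c₂]
          show wordAct (fun j => LinearMap.mul K G (s (b j))) _ (if j = i then Y' y else 0) = _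
          split_ifs <;> simp
      have h₁ := c₃ u
      have hu' : wordAct (fun j => LinearMap.mul K (Dual G) (w j)) u = 0 := hu G.dual w
      rw [hu', LinearMap.zero_apply, Dual.im_zero, ← c₁] at h₁
      have h₂ := congrArg (fun z => f (E z)) h₁
      have h₃ : ∀ z, f (E (Y' z)) = ψ z := fun z => by
        refine (congrArg f (hE false (z, 0) x₀)).trans ?_
        rw [map_smul, op_false, hf]
        simp [x₀, hg]
      simpa [h₃] using h₂.symm
  ext w
  induction w using of_concat_induction generalizing u with
  | one => exact (key u hu).1
  | mul_of w i ih => rw [← coeff_rightDeriv]; exact ih _ ((key u hu).2 i)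

end NAVariety

/-! ### Comparison with Lie algebras -/

namespace NAVariety

variable {K : Type u} [Field K]

theorem lie_mem_iff {A : NAAlg K} : (lie K).mem A ↔ (∀ x : A, x * x = 0) ∧
    ∀ x y z : A, x * (y * z) + y * (z * x) + z * (x * y) = 0 := by
  have hX : ∀ (w : ℕ → A) i, FreeNonUnitalNonAssocAlgebra.lift K w (X K i) = w i :=
    fun w i => FreeNonUnitalNonAssocAlgebra.lift_of_apply K w i
  simp only [lie, ofIdentities, Set.mem_insert_iff, Set.mem_singleton_iff, forall_eq_or_imp,
    forall_eq, NAAlg.Satisfies, map_add, map_mul, hX]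
  refine and_congr ⟨fun h x => h fun _ => x, fun h v => h _⟩ ⟨fun h x y z => ?_, fun h v => h _ _ _⟩
  exact h fun n => match n with
    | 0 => x
    | 1 => y
    | _ => z

theorem Obj.mul_self (A : (lie K).Obj) (x : A) : x * x = 0 := (lie_mem_iff.1 A.mem).1 x

theorem Obj.mul_skew (A : (lie K).Obj) (x y : A) : x * y = -(y * x) := by
  have h := A.mul_self (x + y)
  rw [mul_add, add_mul, add_mul, A.mul_self, A.mul_self, zero_add, add_zero] at h
  exact eq_neg_of_add_eq_zero_right h

theorem Obj.mul_leibniz (A : (lie K).Obj) (x y z : A) :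
    x * (y * z) = x * y * z + y * (x * z) := by
  have h := (lie_mem_iff.1 A.mem).2 x y z
  rw [A.mul_skew z x, A.mul_skew z (x * y), mul_neg] at h
  rw [eq_comm, ← sub_eq_zero, ← neg_eq_zero, ← h]
  abel

instance (A : (lie K).Obj) : LieRing A where
  bracket x y := x * y
  add_lie x y z := add_mul x y z
  lie_add x y z := mul_add x y z
  lie_self := A.mul_self
  leibniz_lie := A.mul_leibniz

theorem Obj.lie_def (A : (lie K).Obj) (x y : A) : ⁅x, y⁆ = x * y := rfl

instance (A : (lie K).Obj) : LieAlgebra K A where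
  lie_smul c x y := mul_smul_comm c x y

attribute [local instance 100] LieRing.ofAssociativeRing

/-- The associative polynomial of a non-associative one, with commutators as products. -/
noncomputable def toWords : FreeNonUnitalNonAssocAlgebra K ℕ →ₙₐ[K] CommutatorRing (Words K) :=
  FreeNonUnitalNonAssocAlgebra.lift K fun i => (MonoidAlgebra.single (.of i) 1 : Words K)

theorem wordAct_toWords {M : Type*} [AddCommGroup M] [Module K M] (F : ℕ → Module.End K M)
    (p : FreeNonUnitalNonAssocAlgebra K ℕ) : wordAct F (toWords p : Words K) =
      FreeNonUnitalNonAssocAlgebra.lift K (A := CommutatorRing (Module.End K M)) F p := by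
  let φ : CommutatorRing (Words K) →ₙₐ[K] CommutatorRing (Module.End K M) :=
    LieHom.toNonUnitalAlgHom (wordAct F : Words K →ₗ⁅K⁆ Module.End K M)
  have h : φ.comp toWords =
      FreeNonUnitalNonAssocAlgebra.lift K (A := CommutatorRing (Module.End K M)) F := by
    refine FreeNonUnitalNonAssocAlgebra.hom_ext K fun i => Eq.trans ?_
      (FreeNonUnitalNonAssocAlgebra.lift_of_apply K (A := CommutatorRing (Module.End K M))
        F i).symm
    have h : (toWords (.of K i) : Words K) = .single (.of i) 1 :=
      FreeNonUnitalNonAssocAlgebra.lift_of_apply K (A := CommutatorRing (Words K)) _ i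
    exact (congrArg (wordAct F) h).trans (by simp [wordAct])
  exact DFunLike.congr_fun h p

theorem lift_comp_lie {A : NAAlg K} {M : Type*} [AddCommGroup M] [Module K M]
    (ρ : A →ₗ[K] Module.End K M) (hρ : ∀ x y, ρ (x * y) = ρ x * ρ y - ρ y * ρ x) (v : ℕ → A)
    (p : FreeNonUnitalNonAssocAlgebra K ℕ) :
    wordAct (fun i => ρ (v i)) (toWords p : Words K) =
      ρ (FreeNonUnitalNonAssocAlgebra.lift K v p) := by
  rw [wordAct_toWords]
  let φ : A →ₙₐ[K] CommutatorRing (Module.End K M) :=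
    { toFun := ρ
      map_smul' := map_smul ρ
      map_zero' := map_zero ρ
      map_add' := map_add ρ
      map_mul' := hρ }
  have h : φ.comp (FreeNonUnitalNonAssocAlgebra.lift K v) =
      FreeNonUnitalNonAssocAlgebra.lift K (A := CommutatorRing (Module.End K M))
        fun i => ρ (v i) := by
    refine FreeNonUnitalNonAssocAlgebra.hom_ext K fun i => Eq.trans ?_
      (FreeNonUnitalNonAssocAlgebra.lift_of_apply K (A := CommutatorRing (Module.End K M))
        (fun i => ρ (v i)) i).symm
    exact congrArg ρ (FreeNonUnitalNonAssocAlgebra.lift_of_apply K v i)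
  exact (DFunLike.congr_fun h p).symm

/-- A non-associative polynomial that vanishes with commutators as products is an identity of
Lie algebras. -/
theorem lift_eq_zero_of_toWords (L : (lie K).Obj) {p : FreeNonUnitalNonAssocAlgebra K ℕ}
    (hp : (toWords p : Words K) = 0) (w : ℕ → L) : FreeNonUnitalNonAssocAlgebra.lift K w p = 0 := by
  obtain ⟨S, _, _, ρ, hinj, hρ⟩ := exists_faithful_representation K L
  apply hinj
  exact (lift_comp_lie ρ hρ w p).symm.trans
    ((congrArg (wordAct _) hp).trans ((map_zero _).trans (map_zero ρ).symm))

/-- A nonabelian alternating variety with cofree split extensions is the variety of Lie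
algebras. -/
theorem HasCofree.eq_lie [Infinite K] {V : NAVariety K} (hV : V.HasCofree)
    (hne : V.IsNonabelian) (halt : V.IsAlternating) : V = lie K := by
  have hle : ∀ A, V.mem A → (lie K).mem A := by
    intro A hA
    refine lie_mem_iff.2 ⟨halt ⟨A, hA⟩, fun x y z => ?_⟩
    have h := hV.leibniz hne ⟨A, hA⟩ x y z
    have hs := hV.isAnticommutative hne ⟨A, hA⟩
    have h₁ : z * x = -(x * z) := hs z x
    have h₂ : z * (x * y) = -(x * y * z) := hs z (x * y)
    have h₃ : x * (y * z) = x * y * z + y * (x * z) := h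
    rw [h₁, h₂, h₃, mul_neg]
    abel
  ext A
  refine ⟨hle A, fun hA => ?_⟩
  obtain ⟨I, hI⟩ := V.exists_identities
  rw [hI]
  intro p hp w
  -- By the Leibniz rule left multiplication sends products to commutators, so `toWords p` acts on
  -- each algebra of `V` as left multiplication by a value of `p`, which is zero.
  have hp₀ : (toWords p : Words K) = 0 := by
    refine hV.coeff_eq_zero hne _ fun A v => ?_
    rw [lift_comp_lie (A := A.alg) (LinearMap.mul K A) (fun x y => ?_) v p,
      (hI _).1 A.mem p hp v, map_zero]
    ext z
    have h : x * (y * z) = x * y * z + y * (x * z) := hV.leibniz hne A x y z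
    show x * y * z = x * (y * z) - y * (x * z)
    rw [h, add_sub_cancel_right]
  exact lift_eq_zero_of_toWords ⟨A, hA⟩ hp₀ w

end NAVariety

/-! ### From cofree objects to universal embeddings; morphisms for Lie algebras -/

namespace NAVariety

open TensorProduct

variable {K : Type u} [Field K]

theorem SplitExt.Hom.onMiddle_eq {V : NAVariety K} {B : V.Obj} {S T : V.SplitExt B}
    (α : SplitExt.Hom S T) {g : S.G} {a : S.A} (h : S.k a = g - S.s (S.f g)) :
    α.onMiddle g = T.s (S.f g) + T.k (α.onKernel a) := by
  rw [← α.comm_k, h, map_sub, α.comm_s, add_sub_cancel]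

theorem SplitExt.exists_k_eq_sub {V : NAVariety K} {B : V.Obj} (S : V.SplitExt B) (g : S.G) :
    ∃ a, S.k a = g - S.s (S.f g) :=
  (S.exact _).1 (by rw [map_sub, S.f_s, sub_self])

theorem SplitExt.Hom.ext_onKernel {V : NAVariety K} {B : V.Obj} {S T : V.SplitExt B}
    {α β : SplitExt.Hom S T} (h : α.onKernel = β.onKernel) : α = β := by
  refine SplitExt.Hom.ext h (NonUnitalAlgHom.ext fun g => ?_)
  obtain ⟨a, ha⟩ := S.exists_k_eq_sub g
  rw [α.onMiddle_eq ha, β.onMiddle_eq ha, h]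

theorem SplitExt.Hom.onMiddle_injective {V : NAVariety K} {B : V.Obj} {S T : V.SplitExt B}
    (α : SplitExt.Hom S T) (h : Function.Injective α.onKernel) :
    Function.Injective α.onMiddle := by
  rw [injective_iff_map_eq_zero]
  intro g hg
  have h₁ : S.f g = 0 := by rw [← α.comm_f, hg, map_zero]
  obtain ⟨a, rfl⟩ := (S.exact g).1 h₁
  rw [α.comm_k] at hg
  rw [h (T.k_injective (hg.trans (map_zero T.k).symm) |>.trans (map_zero _).symm), map_zero]

/-- Cofree objects for kernels give the universal embedding theorem. -/
theorem HasCofree.admitsUniversalEmbedding {V : NAVariety K} (hV : V.HasCofree) :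
    V.AdmitsUniversalEmbedding := by
  intro B
  choose T ε hT using hV B
  choose lift hlift using fun (C : V.Obj) (S : V.SplitExt B) (φ : S.A →ₙₐ[K] C) =>
    (hT C S φ).exists
  have huniq : ∀ {C : V.Obj} {S : V.SplitExt B} {α β : S ⟶ T C},
      (∀ a, ε C (SplitExt.Hom.onKernel α a) = ε C (SplitExt.Hom.onKernel β a)) → α = β :=
    fun {C S α β} h => (hT C S ((ε C).comp (SplitExt.Hom.onKernel β))).unique h fun _ => rfl
  let R : V.Obj ⥤ V.SplitExt B :=
    { obj := T
      map := fun {C C'} g => lift C' (T C) (NonUnitalAlgHom.comp g (ε C))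
      map_id := fun C => huniq (hlift _ _ _)
      map_comp := fun {C C' C''} g h => huniq fun a => by
        refine (hlift _ _ _ a).trans (Eq.trans ?_ (hlift C'' (T C') _ _).symm)
        exact (congrArg (DFunLike.coe (F := C' →ₙₐ[K] C'') h)
          (hlift C' (T C) (NonUnitalAlgHom.comp g (ε C)) a)).symm }
  let η : 𝟭 (V.SplitExt B) ⟶ V.kernelFunctor B ⋙ R :=
    { app := fun S => lift S.A S (NonUnitalAlgHom.id K S.A)
      naturality := fun S S' α => huniq fun a => by
        refine (hlift _ _ _ _).trans (Eq.trans ?_ (hlift S'.A (T S.A) _ _).symm)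
        exact (congrArg (SplitExt.Hom.onKernel α)
          (hlift S.A S (NonUnitalAlgHom.id K S.A) a)).symm }
  have hη : ∀ (S : V.SplitExt B) (a : S.A), ε S.A ((η.app S).onKernel a) = a :=
    fun S a => hlift _ _ _ a
  have hcomp : ∀ (S : V.SplitExt B) (C : V.Obj) (β : S.A →ₙₐ[K] C) (a : S.A),
      ε C ((η.app S ≫ R.map (X := S.A) (Y := C) β).onKernel a) = β a := fun S C β a =>
    (hlift C (T S.A) _ _).trans (congrArg β (hη S a))
  refine ⟨R, η, fun S => SplitExt.Hom.onMiddle_injective _ fun a a' h => ?_, fun S C α =>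
    ⟨(ε C).comp (SplitExt.Hom.onKernel α), huniq (hcomp S C _), fun β hβ => ?_⟩⟩
  · rw [← hη S a, ← hη S a']
    exact congrArg _ h
  · refine NonUnitalAlgHom.ext fun a => ?_
    rw [← hβ]
    exact (hcomp S C β a).symm

/-- A morphism of split extensions of Lie algebras is an equivariant morphism of kernels. -/
theorem SplitExt.exists_hom {B : (lie K).Obj} {S T : (lie K).SplitExt B} (F : S.A →ₙₐ[K] T.A)
    (hF : ∀ b a a', S.k a' = S.s b * S.k a → T.k (F a') = T.s b * T.k (F a)) :
    ∃ α : SplitExt.Hom S T, α.onKernel = F := by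
  choose π hπ using S.exists_k_eq_sub
  have hπ' : ∀ g, g = S.s (S.f g) + S.k (π g) := fun g => by rw [hπ, add_sub_cancel]
  have hπadd : ∀ g g', π (g + g') = π g + π g' := fun g g' => S.k_injective (by
    rw [hπ, map_add, map_add, map_add, hπ, hπ]
    abel)
  have hπsmul : ∀ (c : K) g, π (c • g) = c • π g := fun c g => S.k_injective (by
    rw [hπ, map_smul, map_smul, map_smul, hπ, smul_sub])
  have hπk : ∀ a, π (S.k a) = a := fun a => S.k_injective (by
    rw [hπ, (S.exact _).2 ⟨a, rfl⟩, map_zero, sub_zero])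
  have hπs : ∀ b, π (S.s b) = 0 := fun b => S.k_injective (by
    rw [hπ, S.f_s, sub_self, map_zero])
  have hfk : ∀ a, S.f (S.k a) = 0 := fun a => (S.exact _).2 ⟨a, rfl⟩
  have hTfk : ∀ a, T.f (T.k a) = 0 := fun a => (T.exact _).2 ⟨a, rfl⟩
  let M : S.G → T.G := fun g => T.s (S.f g) + T.k (F (π g))
  have hMadd : ∀ g g', M (g + g') = M g + M g' := fun g g' => by
    simp only [M, map_add, hπadd]
    abel
  have hMs : ∀ b, M (S.s b) = T.s b := fun b => by simp [M, S.f_s, hπs]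
  have hMk : ∀ a, M (S.k a) = T.k (F a) := fun a => by simp [M, hfk, hπk]
  have hMsk : ∀ b a, M (S.s b * S.k a) = T.s b * T.k (F a) := by
    intro b a
    obtain ⟨⟨a', ha'⟩, -⟩ := S.exists_k_eq b a
    rw [← ha', hMk, hF b a a' ha']
  have hMneg : ∀ g, M (-g) = -M g := fun g => by
    have := hMadd g (-g)
    rw [add_neg_cancel] at this
    have h₀ : M 0 = 0 := by
      have := hMs 0
      rwa [map_zero, map_zero] at this
    rw [h₀] at this
    exact eq_neg_of_add_eq_zero_right this.symm
  refine ⟨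
    { onKernel := F
      onMiddle :=
        { toFun := M
          map_smul' := fun c g => by
            simp only [M, map_smul, hπsmul]
            simp
          map_zero' := by
            have := hMs 0
            rwa [map_zero, map_zero] at this
          map_add' := hMadd
          map_mul' := fun g g' => by
            rw [hπ' g, hπ' g']
            simp only [mul_add, add_mul, hMadd, hMs, hMk]
            rw [S.G.mul_skew (S.k _) (S.s _), T.G.mul_skew (T.k _) (T.s _), hMneg, hMsk, hMsk,
              ← map_mul, ← map_mul, ← map_mul, ← map_mul, hMs, hMk, map_mul F, map_mul T.k,
              map_mul S.f] }
      comm_k := hMk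
      comm_f := fun g => by
        show T.f (T.s (S.f g) + T.k (F (π g))) = S.f g
        rw [map_add, T.f_s, hTfk, add_zero]
      comm_s := hMs }, rfl⟩

end NAVariety

/-! ### Semidirect products and coinduced Lie algebras -/

namespace NAVariety

open TensorProduct

variable {K : Type u} [Field K]

section Semidirect

variable {B W : (lie K).Obj} (δ : B →ₗ[K] Module.End K W)
  (hδ : ∀ b x y, δ b (x * y) = δ b x * y + x * δ b y)
  (hδ' : ∀ b b', δ (b * b') = δ b * δ b' - δ b' * δ b)

/-- A Lie algebra, as an object of the variety of Lie algebras. -/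
abbrev ofLie (K L : Type u) [Field K] [LieRing L] [LieAlgebra K L] : (lie K).Obj where
  alg := { carrier := CommutatorRing L }
  mem := lie_mem_iff.2 ⟨fun x => lie_self (L := L) x, fun x y z => lie_jacobi (L := L) x y z⟩

/-- The derivation action given by `δ`. -/
def derivationAction : B →ₗ⁅K⁆ LieDerivation K W W where
  toFun b :=
    { toLinearMap := δ b
      leibniz' := fun x y => by
        rw [W.lie_def, W.lie_def, W.lie_def, hδ, W.mul_skew (δ b x) y]
        abel }
  map_add' b b' := by
    ext x
    exact LinearMap.congr_fun (map_add δ b b') x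
  map_smul' c b := by
    ext x
    exact LinearMap.congr_fun (map_smul δ c b) x
  map_lie' := fun {b b'} => by
    ext x
    exact LinearMap.congr_fun (hδ' b b') x

/-- The split extension of Lie algebras that is given by an action by derivations. -/
def semidirect : (lie K).SplitExt B where
  A := W
  G := ofLie K (W ⋊⁅derivationAction δ hδ hδ'⁆ B)
  k := (LieAlgebra.SemiDirectSum.inl (derivationAction δ hδ hδ')).toNonUnitalAlgHom
  f := (LieAlgebra.SemiDirectSum.projr (derivationAction δ hδ hδ')).toNonUnitalAlgHom
  s := (LieAlgebra.SemiDirectSum.inr (derivationAction δ hδ hδ')).toNonUnitalAlgHom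
  f_s _ := rfl
  k_injective := LieAlgebra.SemiDirectSum.inl_injective _
  exact g := by
    constructor
    · intro h
      exact ⟨g.left, LieAlgebra.SemiDirectSum.ext rfl h.symm⟩
    · rintro ⟨a, rfl⟩
      rfl

theorem semidirect_s_mul_k (b : B) (w : W) :
    (semidirect δ hδ hδ').s b * (semidirect δ hδ hδ').k w =
      (semidirect δ hδ hδ').k (δ b w) := by
  refine LieAlgebra.SemiDirectSum.ext ?_ ?_
  · show ⁅(0 : W), w⁆ + δ b w - δ 0 0 = δ b w
    simp
  · show ⁅b, (0 : B)⁆ = 0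
    simp

end Semidirect

section Coinduced

attribute [local instance 100] LieRing.ofAssociativeRing

/-- The enveloping algebra of an object. -/
abbrev Env (B : (lie K).Obj) := UniversalEnvelopingAlgebra K B

/-- The subalgebra generated by `B` is everything, by the universal property. Letters are appended
on the right because `B` acts on functions by right translation of the argument. -/
theorem env_induction {B : (lie K).Obj} {P : Env B → Prop}
    (add : ∀ u v, P u → P v → P (u + v)) (smul : ∀ (c : K) u, P u → P (c • u)) (one : P 1)
    (mul_ι : ∀ u b, P u → P (u * UniversalEnvelopingAlgebra.ι K b)) (u : Env B) : P u := by
  let N : Subalgebra K (Env B) := Algebra.adjoin K (Set.range (UniversalEnvelopingAlgebra.ι K))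
  have hN : ∀ u, u ∈ N := by
    let φ : Env B →ₐ[K] N := UniversalEnvelopingAlgebra.lift K
      { toFun := fun b => ⟨UniversalEnvelopingAlgebra.ι K b, Algebra.subset_adjoin ⟨b, rfl⟩⟩
        map_add' := fun _ _ => Subtype.ext (map_add _ _ _)
        map_smul' := fun _ _ => Subtype.ext (map_smul _ _ _)
        map_lie' := fun {_ _} => Subtype.ext (LieHom.map_lie _ _ _) }
    have h : N.val.comp φ = AlgHom.id K _ := by
      refine UniversalEnvelopingAlgebra.hom_ext K (LieHom.ext fun b => ?_)
      show (φ (UniversalEnvelopingAlgebra.ι K b) : Env B) = UniversalEnvelopingAlgebra.ι K b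
      rw [UniversalEnvelopingAlgebra.lift_ι_apply]
      rfl
    intro u
    have := DFunLike.congr_fun h u
    rw [← show N.val (φ u) = u from this]
    exact (φ u).2
  have key : ∀ v ∈ N, ∀ u, P u → P (u * v) := by
    intro v hv
    induction hv using Algebra.adjoin_induction with
    | mem v hv =>
      obtain ⟨b, rfl⟩ := hv
      exact fun u hu => mul_ι u b hu
    | algebraMap c =>
      intro u hu
      rw [← Algebra.commutes, ← Algebra.smul_def]
      exact smul c u hu
    | add v w _ _ hv hw =>
      intro u hu
      rw [mul_add]
      exact add _ _ (hv u hu) (hw u hu)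
    | mul v w _ _ hv hw =>
      intro u hu
      rw [← mul_assoc]
      exact hw _ (hv u hu)
  simpa using key u (hN u) 1 one

/-- The comultiplication of the enveloping algebra. -/
noncomputable def comul (B : (lie K).Obj) : Env B →ₐ[K] Env B ⊗[K] Env B :=
  UniversalEnvelopingAlgebra.lift K
    { toFun := fun b => UniversalEnvelopingAlgebra.ι K b ⊗ₜ 1 + 1 ⊗ₜ UniversalEnvelopingAlgebra.ι K b
      map_add' := fun b b' => by
        rw [map_add, TensorProduct.add_tmul, TensorProduct.tmul_add]
        abel
      map_smul' := fun c b => by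
        rw [map_smul, ← TensorProduct.smul_tmul', TensorProduct.tmul_smul, RingHom.id_apply, smul_add]
      map_lie' := fun {b b'} => by
        rw [LieHom.map_lie, LieRing.of_associative_ring_bracket,
          LieRing.of_associative_ring_bracket]
        simp only [TensorProduct.sub_tmul, TensorProduct.tmul_sub, mul_add, add_mul,
          Algebra.TensorProduct.tmul_mul_tmul, one_mul, mul_one]
        abel }

theorem comul_ι {B : (lie K).Obj} (b : B) : comul B (UniversalEnvelopingAlgebra.ι K b) =
    UniversalEnvelopingAlgebra.ι K b ⊗ₜ 1 + 1 ⊗ₜ UniversalEnvelopingAlgebra.ι K b :=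
  UniversalEnvelopingAlgebra.lift_ι_apply K _ b

/-- Linear maps from the enveloping algebra of `B` to `C`. -/
def Coind (B C : (lie K).Obj) : Type u := Env B →ₗ[K] C

namespace Coind

variable {B C : (lie K).Obj}

instance : AddCommGroup (Coind B C) := inferInstanceAs (AddCommGroup (Env B →ₗ[K] C))
noncomputable instance : Module K (Coind B C) := inferInstanceAs (Module K (Env B →ₗ[K] C))

/-- The underlying linear map. -/
def toLin (f : Coind B C) : Env B →ₗ[K] C := f

/-- Evaluation, linear in the function. -/
def eval (u : Env B) : Coind B C →ₗ[K] C := LinearMap.applyₗ (M₂ := C) (R := K) u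

theorem ext {f g : Coind B C} (h : ∀ u, eval u f = eval u g) : f = g := LinearMap.ext h

theorem eval_add' (u v : Env B) (f : Coind B C) : eval (u + v) f = eval u f + eval v f :=
  map_add (toLin f) u v

theorem eval_smul' (c : K) (u : Env B) (f : Coind B C) : eval (c • u) f = c • eval u f :=
  map_smul (toLin f) c u

/-- The action of the base. -/
noncomputable def act : B →ₗ[K] Module.End K (Coind B C) where
  toFun b :=
    { toFun := fun f => (toLin f).comp (LinearMap.mulRight K (UniversalEnvelopingAlgebra.ι K b))
      map_add' := fun f g => rfl
      map_smul' := fun c f => rfl }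
  map_add' b b' := LinearMap.ext fun f => ext fun u => by
    show eval (u * UniversalEnvelopingAlgebra.ι K (b + b')) f = eval (u * _) f + eval (u * _) f
    rw [map_add, mul_add, eval_add']
  map_smul' c b := LinearMap.ext fun f => ext fun u => by
    show eval (u * UniversalEnvelopingAlgebra.ι K (c • b)) f = c • eval (u * _) f
    rw [map_smul, mul_smul_comm, eval_smul']

theorem eval_act (u : Env B) (b : B) (f : Coind B C) :
    eval u (act b f) = eval (u * UniversalEnvelopingAlgebra.ι K b) f := rfl

/-- The bilinear pairing on tensors from which the convolution is obtained. -/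
noncomputable def pairing (f g : Coind B C) : Env B ⊗[K] Env B →ₗ[K] C :=
  TensorProduct.lift ((LinearMap.mul K C).compl₁₂ (toLin f) (toLin g))

theorem pairing_tmul (f g : Coind B C) (x y : Env B) :
    pairing f g (x ⊗ₜ y) = eval x f * eval y g := rfl

noncomputable instance : Mul (Coind B C) :=
  ⟨fun f g => (pairing f g ∘ₗ (comul B).toLinearMap : Env B →ₗ[K] C)⟩

theorem eval_mul (u : Env B) (f g : Coind B C) : eval u (f * g) = pairing f g (comul B u) := rfl

theorem pairing_congr {f g : Coind B C} {p : Env B ⊗[K] Env B →ₗ[K] C}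
    (h : ∀ x y, p (x ⊗ₜ y) = eval x f * eval y g) : pairing f g = p :=
  TensorProduct.ext' fun x y => (h x y).symm

theorem eval_one_mul (f g : Coind B C) : eval 1 (f * g) = eval 1 f * eval 1 g := by
  rw [eval_mul, map_one, Algebra.TensorProduct.one_def, pairing_tmul]

noncomputable instance : NonUnitalNonAssocRing (Coind B C) where
  left_distrib f g h := ext fun u => by
    rw [map_add, eval_mul, eval_mul, eval_mul, ← LinearMap.add_apply]
    rw [pairing_congr (f := f) (g := g + h)]
    intro x y
    rw [LinearMap.add_apply, pairing_tmul, pairing_tmul, map_add, mul_add]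
  right_distrib f g h := ext fun u => by
    rw [map_add, eval_mul, eval_mul, eval_mul, ← LinearMap.add_apply]
    rw [pairing_congr (f := f + g) (g := h)]
    intro x y
    rw [LinearMap.add_apply, pairing_tmul, pairing_tmul, map_add, add_mul]
  zero_mul f := ext fun u => by
    rw [map_zero, eval_mul, pairing_congr (f := 0) (g := f) (p := 0), LinearMap.zero_apply]
    simp
  mul_zero f := ext fun u => by
    rw [map_zero, eval_mul, pairing_congr (f := f) (g := 0) (p := 0), LinearMap.zero_apply]
    simp

instance : IsScalarTower K (Coind B C) (Coind B C) where
  smul_assoc c f g := ext fun u => by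
    rw [smul_eq_mul, smul_eq_mul, map_smul, eval_mul, eval_mul, ← LinearMap.smul_apply]
    rw [pairing_congr (f := c • f) (g := g)]
    intro x y
    rw [LinearMap.smul_apply, pairing_tmul, map_smul, smul_mul_assoc]

instance : SMulCommClass K (Coind B C) (Coind B C) where
  smul_comm c f g := ext fun u => by
    rw [smul_eq_mul, smul_eq_mul, map_smul, eval_mul, eval_mul, ← LinearMap.smul_apply]
    rw [pairing_congr (f := f) (g := c • g)]
    intro x y
    rw [LinearMap.smul_apply, pairing_tmul, map_smul, mul_smul_comm]

/-- Elements of `B` are primitive for the comultiplication, so right translation by them is a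
derivation of the convolution product. -/
theorem act_mul (b : B) (f g : Coind B C) : act b (f * g) = act b f * g + f * act b g := by
  refine ext fun u => ?_
  rw [map_add, eval_act, eval_mul, eval_mul, eval_mul, map_mul, comul_ι, mul_add, map_add]
  congr 1
  · generalize comul B u = t
    induction t with
    | zero => simp
    | add s t hs ht => rw [add_mul, map_add, hs, ht, map_add]
    | tmul x y => rw [Algebra.TensorProduct.tmul_mul_tmul, mul_one, pairing_tmul, pairing_tmul,
        eval_act]
  · generalize comul B u = t
    induction t with
    | zero => simp
    | add s t hs ht => rw [add_mul, map_add, hs, ht, map_add]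
    | tmul x y => rw [Algebra.TensorProduct.tmul_mul_tmul, mul_one, pairing_tmul, pairing_tmul,
        eval_act]

theorem act_lie (b b' : B) : (act (b * b') : Module.End K (Coind B C)) =
    act b * act b' - act b' * act b := by
  refine LinearMap.ext fun f => ext fun u => ?_
  show eval (u * UniversalEnvelopingAlgebra.ι K ⁅b, b'⁆) f =
    eval (u * _ * _) f - eval (u * _ * _) f
  rw [LieHom.map_lie, LieRing.of_associative_ring_bracket, mul_sub, mul_assoc, mul_assoc,
    eq_sub_iff_add_eq, ← eval_add', sub_add_cancel]

/-- Functions on the enveloping algebra that vanish at `1`, for all arguments of a family that is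
stable under the action, vanish. -/
theorem eval_eq_zero {ι : Type*} (F : ι → Coind B C) (h₁ : ∀ i, eval 1 (F i) = 0)
    (hF : ∀ (b : B) i, act b (F i) ∈ Submodule.span K (Set.range F)) (i : ι) : F i = 0 := by
  refine ext fun u => ?_
  rw [map_zero]
  induction u using env_induction generalizing i with
  | add u v hu hv => rw [eval_add', hu, hv, add_zero]
  | smul c u hu => rw [eval_smul', hu, smul_zero]
  | one => exact h₁ i
  | mul_ι u b hu =>
    rw [← eval_act]
    have : Submodule.span K (Set.range F) ≤ LinearMap.ker (eval u) := by
      rw [Submodule.span_le]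
      rintro _ ⟨j, rfl⟩
      exact hu j
    exact this (hF b i)

theorem mul_skew (f g : Coind B C) : f * g + g * f = 0 := by
  -- Evaluation at `1` is multiplicative, so the identity holds there because it holds in `C`; as
  -- `B` acts by derivations, the family of all its instances is stable.
  refine eval_eq_zero (fun i : Coind B C × Coind B C => i.1 * i.2 + i.2 * i.1) (fun i => ?_)
    (fun b i => ?_) (f, g)
  · rw [map_add, eval_one_mul, eval_one_mul, C.mul_skew, neg_add_cancel]
  · have := Submodule.add_mem _
      (Submodule.subset_span (R := K) (s := Set.range fun i : Coind B C × Coind B C =>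
        i.1 * i.2 + i.2 * i.1) ⟨(act b i.1, i.2), rfl⟩)
      (Submodule.subset_span ⟨(i.1, act b i.2), rfl⟩)
    convert this using 1
    simp only [map_add, act_mul]
    abel

theorem mul_self (f : Coind B C) : f * f = 0 := by
  refine eval_eq_zero (fun f : Coind B C => f * f) (fun f => ?_) (fun b f => ?_) f
  · rw [eval_one_mul, C.mul_self]
  · rw [act_mul, mul_skew]
    exact Submodule.zero_mem _

theorem jacobi (f g h : Coind B C) : f * (g * h) + g * (h * f) + h * (f * g) = 0 := by
  refine eval_eq_zero (fun i : Coind B C × Coind B C × Coind B C =>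
    i.1 * (i.2.1 * i.2.2) + i.2.1 * (i.2.2 * i.1) + i.2.2 * (i.1 * i.2.1)) (fun i => ?_)
    (fun b i => ?_) (f, g, h)
  · simp only [map_add, eval_one_mul]
    exact (lie_mem_iff.1 C.mem).2 _ _ _
  · have h : ∀ i, _ ∈ _ := fun i => Submodule.subset_span (R := K)
      (Set.mem_range_self (f := fun i : Coind B C × Coind B C × Coind B C =>
        i.1 * (i.2.1 * i.2.2) + i.2.1 * (i.2.2 * i.1) + i.2.2 * (i.1 * i.2.1)) i)
    have := Submodule.add_mem _ (Submodule.add_mem _ (h (act b i.1, i.2.1, i.2.2))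
      (h (i.1, act b i.2.1, i.2.2))) (h (i.1, i.2.1, act b i.2.2))
    convert this using 1
    simp only [map_add, act_mul, mul_add]
    abel

end Coind

end Coinduced

end NAVariety

/-! ### Cofree split extensions of Lie algebras -/

namespace NAVariety

variable {K : Type u} [Field K]

attribute [local instance 100] LieRing.ofAssociativeRing

/-- The coinduced Lie algebra. -/
noncomputable abbrev coind (B C : (lie K).Obj) : (lie K).Obj where
  alg := { carrier := Coind B C }
  mem := lie_mem_iff.2 ⟨Coind.mul_self, Coind.jacobi⟩

/-- The variety of Lie algebras has cofree split extensions. -/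
theorem hasCofree_lie (K : Type u) [Field K] : (lie K).HasCofree := by
  intro B C
  let T : (lie K).SplitExt B := semidirect (W := coind B C) Coind.act Coind.act_mul Coind.act_lie
  let ε : Coind B C →ₙₐ[K] C :=
    { toFun := Coind.eval 1
      map_smul' := map_smul (Coind.eval 1)
      map_zero' := map_zero (Coind.eval 1)
      map_add' := map_add (Coind.eval 1)
      map_mul' := Coind.eval_one_mul }
  have hT : ∀ b (w : Coind B C), T.s b * T.k w = T.k (Coind.act b w) :=
    semidirect_s_mul_k (W := coind B C) Coind.act Coind.act_mul Coind.act_lie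
  refine ⟨T, ε, fun S φ => ?_⟩
  choose δ hδ using fun b a => (S.exists_k_eq b a).1
  let D : B →ₗ⁅K⁆ Module.End K S.A :=
    { toFun := fun b =>
        { toFun := δ b
          map_add' := fun a a' => S.k_injective (by
            rw [map_add, hδ, hδ, hδ, map_add, mul_add])
          map_smul' := fun c a => S.k_injective (by
            rw [RingHom.id_apply, map_smul, hδ, hδ, map_smul, mul_smul_comm]) }
      map_add' := fun b b' => LinearMap.ext fun a => S.k_injective (by
        show S.k (δ (b + b') a) = S.k (δ b a + δ b' a)
        rw [map_add, hδ, hδ, hδ, map_add, add_mul])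
      map_smul' := fun c b => LinearMap.ext fun a => S.k_injective (by
        show S.k (δ (c • b) a) = S.k (c • δ b a)
        rw [map_smul, hδ, hδ, map_smul, smul_mul_assoc])
      map_lie' := fun {b b'} => LinearMap.ext fun a => S.k_injective (by
        show S.k (δ (b * b') a) = S.k (δ b (δ b' a) - δ b' (δ b a))
        rw [map_sub, hδ, hδ, hδ, hδ, hδ, S.G.mul_leibniz (S.s b), map_mul, add_sub_cancel_right]) }
  have hD : ∀ b a, S.k (D b a) = S.s b * S.k a := hδ
  have hDmul : ∀ b a a', D b (a * a') = D b a * a' + a * D b a' := fun b a a' => S.k_injective (by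
    rw [hD, map_mul, map_add, map_mul, map_mul, hD, hD, S.G.mul_leibniz])
  let ρ : Env B →ₐ[K] Module.End K S.A := UniversalEnvelopingAlgebra.lift K D
  have hρ : ∀ u b a, ρ (u * UniversalEnvelopingAlgebra.ι K b) a = ρ u (D b a) := by
    intro u b a
    rw [map_mul, UniversalEnvelopingAlgebra.lift_ι_apply]
    rfl
  let φₗ : S.A →ₗ[K] C := { φ with map_smul' := map_smul φ }
  -- The lift is `a ↦ (u ↦ φ(u·a))`. Equivariance and the value at `1` determine it on all of the
  -- enveloping algebra, and the same induction gives multiplicativity.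
  let F₀ : S.A → Coind B C := fun a => φₗ ∘ₗ LinearMap.applyₗ a ∘ₗ ρ.toLinearMap
  have hF₀ : ∀ a u, Coind.eval u (F₀ a) = φ (ρ u a) := fun a u => rfl
  have hact : ∀ b a, Coind.act b (F₀ a) = F₀ (D b a) := fun b a => Coind.ext fun u => by
    rw [Coind.eval_act, hF₀, hF₀, hρ]
  have hmul : ∀ a a', F₀ (a * a') = F₀ a * F₀ a' := by
    intro a a'
    refine Coind.ext fun u => ?_
    induction u using env_induction generalizing a a' with
    | add u v hu hv => rw [Coind.eval_add', hu, hv, Coind.eval_add']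
    | smul c u hu => rw [Coind.eval_smul', hu, Coind.eval_smul']
    | one => rw [Coind.eval_one_mul, hF₀, hF₀, hF₀, map_one, ← map_mul]; rfl
    | mul_ι u b hu =>
      rw [← Coind.eval_act, ← Coind.eval_act, hact, Coind.act_mul, hact, hact, map_add, ← hu, ← hu,
        hDmul, hF₀, hF₀, hF₀, map_add, map_add]
  let F : S.A →ₙₐ[K] Coind B C :=
    { toFun := F₀
      map_smul' := fun c a => Coind.ext fun u => by
        rw [map_smul, hF₀, hF₀, map_smul, map_smul]
        rfl
      map_zero' := Coind.ext fun u => by rw [hF₀, map_zero, map_zero, map_zero]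
      map_add' := fun a a' => Coind.ext fun u => by rw [map_add, hF₀, hF₀, hF₀, map_add, map_add]
      map_mul' := hmul }
  obtain ⟨α, hα⟩ := SplitExt.exists_hom (S := S) (T := T) F fun b a a' h => by
    rw [← hD] at h
    rw [S.k_injective h]
    exact (congrArg T.k (hact b a).symm).trans (hT b (F a)).symm
  refine ⟨α, fun a => ?_, fun β hβ => SplitExt.Hom.ext_onKernel (NonUnitalAlgHom.ext fun a => ?_)⟩
  · rw [hα]
    show φ (ρ 1 a) = φ a
    rw [map_one]
    rfl
  · rw [hα]
    let β₀ : S.A → Coind B C := β.onKernel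
    have hβ₁ : ∀ a, Coind.eval 1 (β₀ a) = φ a := hβ
    have hβD : ∀ b a, Coind.act b (β₀ a) = β₀ (D b a) := by
      intro b a
      apply T.k_injective
      refine (hT b (β₀ a)).symm.trans ?_
      show T.s b * T.k (β.onKernel a) = T.k (β.onKernel (D b a))
      rw [← β.comm_k, ← β.comm_k, hD, map_mul, β.comm_s]
    show β₀ a = F₀ a
    refine Coind.ext fun u => ?_
    induction u using env_induction generalizing a with
    | add u v hu hv => rw [Coind.eval_add', hu, hv, Coind.eval_add']
    | smul c u hu => rw [Coind.eval_smul', hu, Coind.eval_smul']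
    | one => rw [hβ₁, hF₀, map_one]; rfl
    | mul_ι u b hu => rw [← Coind.eval_act, ← Coind.eval_act, hact, hβD, hu]

end NAVariety

/-! ### The four examples -/

namespace NAVariety

variable {K : Type u} [Field K]

/-- The Leibniz rule for three copies of `1` would read `1 = 1 + 1`. -/
theorem HasCofree.not_mem_base [Infinite K] {V : NAVariety K} (hV : V.HasCofree) :
    ¬ V.mem { carrier := K } := by
  intro hK
  let A : V.Obj := ⟨{ carrier := K }, hK⟩
  have h := hV.leibniz ⟨A, (1 : K), (1 : K), mul_ne_zero one_ne_zero one_ne_zero⟩ A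
    (1 : K) (1 : K) (1 : K)
  have h' : (1 : K) * (1 * 1) = 1 * 1 * 1 + 1 * (1 * 1) := h
  simp at h'

/-- The algebra of pairs with the product `(a, m) (b, n) = (0, a n)`. -/
@[ext] structure LeftUnital (K : Type u) where
  fst : K
  snd : K

namespace LeftUnital

/-- The elements as pairs. -/
def equivProd : LeftUnital K ≃ K × K where
  toFun x := (x.fst, x.snd)
  invFun x := ⟨x.1, x.2⟩
  left_inv _ := rfl
  right_inv _ := rfl

instance : AddCommGroup (LeftUnital K) := equivProd.addCommGroup
instance : Module K (LeftUnital K) := equivProd.module K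
instance : Mul (LeftUnital K) := ⟨fun x y => ⟨0, x.fst * y.snd⟩⟩

@[simp] theorem fst_zero : (0 : LeftUnital K).fst = 0 := rfl
@[simp] theorem snd_zero : (0 : LeftUnital K).snd = 0 := rfl
@[simp] theorem fst_add (x y : LeftUnital K) : (x + y).fst = x.fst + y.fst := rfl
@[simp] theorem snd_add (x y : LeftUnital K) : (x + y).snd = x.snd + y.snd := rfl
@[simp] theorem snd_neg (x : LeftUnital K) : (-x).snd = -x.snd := rfl
@[simp] theorem fst_smul (c : K) (x : LeftUnital K) : (c • x).fst = c * x.fst := rfl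
@[simp] theorem snd_smul (c : K) (x : LeftUnital K) : (c • x).snd = c * x.snd := rfl
@[simp] theorem fst_mul (x y : LeftUnital K) : (x * y).fst = 0 := rfl
@[simp] theorem snd_mul (x y : LeftUnital K) : (x * y).snd = x.fst * y.snd := rfl

instance : NonUnitalNonAssocRing (LeftUnital K) where
  left_distrib x y z := by ext <;> simp [mul_add]
  right_distrib x y z := by ext <;> simp [add_mul]
  zero_mul x := by ext <;> simp
  mul_zero x := by ext <;> simp

instance : IsScalarTower K (LeftUnital K) (LeftUnital K) where
  smul_assoc c x y := by ext <;> simp [mul_assoc]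

instance : SMulCommClass K (LeftUnital K) (LeftUnital K) where
  smul_comm c x y := by ext <;> simp [mul_left_comm]

theorem leibniz (x y z : LeftUnital K) : x * (y * z) = x * y * z + y * (x * z) := by
  ext <;> simp [mul_left_comm]

end LeftUnital

/-- Here the Leibniz rule holds, and anticommutativity is what fails: `(1, 0)(0, 1)` is nonzero
while the opposite product is zero. -/
theorem HasCofree.not_mem_leftUnital [Infinite K] {V : NAVariety K} (hV : V.HasCofree) :
    ¬ V.mem { carrier := LeftUnital K } := by
  intro hK
  let A : V.Obj := ⟨{ carrier := LeftUnital K }, hK⟩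
  let x : LeftUnital K := ⟨1, 0⟩
  let y : LeftUnital K := ⟨0, 1⟩
  have hxy : (x * y).snd = 1 := by simp [x, y]
  have hne : x * y ≠ 0 := fun h => by
    rw [h] at hxy
    exact zero_ne_one hxy
  have h : x * y = -(y * x) := hV.isAnticommutative ⟨A, x, y, hne⟩ A x y
  rw [h] at hxy
  simp [x, y] at hxy

theorem HasCofree.not_mem_leftUnital_op [Infinite K] {V : NAVariety K} (hV : V.HasCofree) :
    ¬ V.mem { carrier := (LeftUnital K)ᵐᵒᵖ } := by
  intro hK
  let A : V.Obj := ⟨{ carrier := (LeftUnital K)ᵐᵒᵖ }, hK⟩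
  let x : LeftUnital K := ⟨1, 0⟩
  let y : LeftUnital K := ⟨0, 1⟩
  have hxy : (x * y).snd = 1 := by simp [x, y]
  have hne : MulOpposite.op y * MulOpposite.op x ≠ 0 := fun h => by
    have h' : x * y = 0 := congrArg MulOpposite.unop h
    rw [h'] at hxy
    exact zero_ne_one hxy
  have h : MulOpposite.op y * MulOpposite.op x = -(MulOpposite.op x * MulOpposite.op y) :=
    hV.isAnticommutative ⟨A, _, _, hne⟩ A (MulOpposite.op y) (MulOpposite.op x)
  have h' : x * y = -(y * x) := congrArg MulOpposite.unop h
  rw [h'] at hxy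
  simp [x, y] at hxy

section Examples

variable (K)

theorem lift_X {A : NAAlg K} (w : ℕ → A) (i : ℕ) :
    FreeNonUnitalNonAssocAlgebra.lift K w (X K i) = w i :=
  FreeNonUnitalNonAssocAlgebra.lift_of_apply K w i

theorem associative_mem_base : (associative K).mem { carrier := K } := by
  simp only [associative, ofIdentities, Set.mem_singleton_iff, forall_eq, NAAlg.Satisfies, map_sub,
    map_mul, lift_X]
  intro v
  rw [sub_eq_zero]
  exact mul_assoc (G := K) _ _ _

theorem jordan_mem_base : (jordan K).mem { carrier := K } := by
  simp only [jordan, ofIdentities, Set.mem_insert_iff, Set.mem_singleton_iff, forall_eq_or_imp,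
    forall_eq, NAAlg.Satisfies, map_sub, map_mul, lift_X]
  refine ⟨fun v => ?_, fun v => ?_⟩
  · rw [sub_eq_zero]
    exact mul_comm (G := K) _ _
  · rw [sub_eq_zero]
    exact mul_assoc (G := K) _ _ _

theorem leftLeibniz_mem_leftUnital : (leftLeibniz K).mem { carrier := LeftUnital K } := by
  simp only [leftLeibniz, ofIdentities, Set.mem_singleton_iff, forall_eq, NAAlg.Satisfies, map_sub,
    map_add, map_mul, lift_X]
  intro v
  rw [sub_eq_zero]
  exact LeftUnital.leibniz _ _ _

theorem rightLeibniz_mem_leftUnital_op :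
    (rightLeibniz K).mem { carrier := (LeftUnital K)ᵐᵒᵖ } := by
  simp only [rightLeibniz, ofIdentities, Set.mem_singleton_iff, forall_eq, NAAlg.Satisfies, map_sub,
    map_add, map_mul, lift_X]
  intro v
  rw [sub_eq_zero]
  refine MulOpposite.unop_injective ?_
  refine (LeftUnital.leibniz (MulOpposite.unop (v 2)) (MulOpposite.unop (v 1))
    (MulOpposite.unop (v 0))).trans (add_comm _ _)

end Examples

end NAVariety

theorem mainTheorem2 (K : Type u) [Field K] [Infinite K] :
    (∀ V : NAVariety K, V.IsNonabelian → (V.IsAnticommutative → V.IsAlternating) →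
      (V.AdmitsUniversalEmbedding ↔ V = NAVariety.lie K)) ∧
    ¬ (NAVariety.associative K).AdmitsUniversalEmbedding ∧
    ¬ (NAVariety.jordan K).AdmitsUniversalEmbedding ∧
    ¬ (NAVariety.leftLeibniz K).AdmitsUniversalEmbedding ∧
    ¬ (NAVariety.rightLeibniz K).AdmitsUniversalEmbedding := by
  refine ⟨fun V hne halt => ⟨fun h => ?_, ?_⟩, fun h => ?_, fun h => ?_, fun h => ?_, fun h => ?_⟩
  · exact h.hasCofree.eq_lie hne (halt (h.hasCofree.isAnticommutative hne))
  · rintro rfl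
    exact (NAVariety.hasCofree_lie K).admitsUniversalEmbedding
  · exact h.hasCofree.not_mem_base (NAVariety.associative_mem_base K)
  · exact h.hasCofree.not_mem_base (NAVariety.jordan_mem_base K)
  · exact h.hasCofree.not_mem_leftUnital (NAVariety.leftLeibniz_mem_leftUnital K)
  · exact h.hasCofree.not_mem_leftUnital_op (NAVariety.rightLeibniz_mem_leftUnital_op K)
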